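/- Throughout, Hilbert spaces are complex, separable and nonzero, of finite or infinite dimension. $\mathfrak T(\mathcal H)$ denotes the space of trace class operators on $\mathcal H$, and a *quantum channel* $\Phi:\mathfrak T(\mathcal H_A)\to\mathfrak T(\mathcal H_B)$ is a completely positive trace-preserving linear map. A family $\mathfrak S$ of pure states $|\varphi_\lambda\rangle\langle\varphi_\lambda|$ ($\|\varphi_\lambda\|=1$) on $\mathcal H$ is called *complete* if the linear hull of the vectors $\varphi_\lambda$ is dense in $\mathcal H$; *orthogonal* if any two different members are orthogonal; and *nonorthogonal* if its members are mutually nonorthogonal, i.e. $\langle\varphi_\lambda|\varphi_\mu\rangle\neq 0$ for all $\lambda,\mu$. A channel $\Phi:\mathfrak T(\mathcal H_A)\to\mathfrak T(\mathcal H_B)$ is *reversible with respect to* a family $\mathfrak S$ of states on $\mathcal H_A$ if there is a channel $\Lambda:\mathfrak T(\mathcal H_B)\to\mathfrak T(\mathcal H_A)$ with $\Lambda(\Phi(\rho))=\rho$ for all $\rho\in\mathfrak S$. The first component $\mathrm{ri}_1(\Phi)\in\{0,1,2\}$ of the reversibility index of $\Phi$ is defined by - $\mathrm{ri}_1(\Phi)=0$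 if $\Phi$ is not reversible with respect to any complete family of pure states; - $\mathrm{ri}_1(\Phi)=1$ if $\Phi$ is reversible with respect to some complete orthogonal family of pure states, but not with respect to any complete nonorthogonal family of pure states; - $\mathrm{ri}_1(\Phi)=2$ if $\Phi$ is reversible with respect to some complete nonorthogonal family of pure states. **Proposition.** For every channel exactly one of these three cases occurs, so that $\mathrm{ri}_1$ is well defined. Let $\Phi:\mathfrak T(\mathcal H_A)\to\mathfrak T(\mathcal H_B)$ and $\Psi:\mathfrak T(\mathcal H_C)\to\mathfrak T(\mathcal H_D)$ be arbitrary quantum channels, and let $\Phi\otimes\Psi:\mathfrak T(\mathcal H_A\otimes\mathcal H_C)\to\mathfrak T(\mathcal H_B\otimes\mathcal H_D)$ be their tensor product, i.e. the unique channel with $(\Phi\otimes\Psi)(\rho\otimes\sigma)=\Phi(\rho)\otimes\Psi(\sigma)$ for all $\rho\in\mathfrak T(\mathcal H_A)$, $\sigma\in\mathfrak T(\mathcal H_C)$. Then $$\mathrm{ri}_1(\Phi\otimes\Psi)=\min\{\mathrm{ri}_1(\Phi),\mathrm{ri}_1(\Psi)\}.$$ In particular, if one of $\Phi$, $\Psi$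 is not reversible with respect to any complete family of pure states, then neither is $\Phi\otimes\Psi$. -/

import Mathlib

open scoped ComplexOrder TensorProduct InnerProductSpace

noncomputable section

namespace QuantumReversibility

/-- A bounded operator on a Hilbert space is trace class if it is an absolutely convergent sum
`∑ₙ |xₙ⟩⟨yₙ|` of rank one operators, that is `∑ₙ ‖xₙ‖ ‖yₙ‖ < ∞` (so the sum converges in operator
norm, and the infimum of `∑ₙ ‖xₙ‖ ‖yₙ‖` over all such sums is the trace norm). -/
def IsTraceClass {H : Type*} [NormedAddCommGroup H] [InnerProductSpace ℂ H]
    (T : H →L[ℂ] H) : Prop :=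
  ∃ x y : ℕ → H, Summable (fun n => ‖x n‖ * ‖y n‖) ∧
    HasSum (fun n => InnerProductSpace.rankOne ℂ (x n) (y n)) T

theorem IsTraceClass.of_denumerable {H : Type*} [NormedAddCommGroup H] [InnerProductSpace ℂ H]
    {ι : Type*} [Denumerable ι] {T : H →L[ℂ] H} (x y : ι → H)
    (hs : Summable (fun i => ‖x i‖ * ‖y i‖))
    (hT : HasSum (fun i => InnerProductSpace.rankOne ℂ (x i) (y i)) T) : IsTraceClass T := by
  let e : ℕ ≃ ι := (Denumerable.eqv ι).symm
  exact ⟨x ∘ e, y ∘ e, e.summable_iff.mpr hs,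
    (e.hasSum_iff (f := fun i => InnerProductSpace.rankOne ℂ (x i) (y i))).mpr hT⟩

theorem isTraceClass_rankOne {H : Type*} [NormedAddCommGroup H] [InnerProductSpace ℂ H]
    (x y : H) : IsTraceClass (InnerProductSpace.rankOne ℂ x y) := by
  refine ⟨fun n => if n = 0 then x else 0, fun n => if n = 0 then y else 0, ?_, ?_⟩
  · refine summable_of_ne_finset_zero (s := {0}) fun n hn => ?_
    have : n ≠ 0 := by simpa using hn
    simp [this]
  · have h := hasSum_ite_eq (0 : ℕ) (InnerProductSpace.rankOne ℂ x y)
    refine h.congr_fun ?_ |> fun h => h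
    intro n
    by_cases hn : n = 0 <;> simp [hn]

/-- The space `𝔗(H)` of trace class operators on `H`, as a subspace of the bounded operators. -/
def traceClass (H : Type*) [NormedAddCommGroup H] [InnerProductSpace ℂ H] :
    Submodule ℂ (H →L[ℂ] H) where
  carrier := {T | IsTraceClass T}
  zero_mem' := by
    simpa using isTraceClass_rankOne (0 : H) 0
  add_mem' := by
    rintro S T ⟨x, y, hs, hS⟩ ⟨x', y', hs', hT⟩
    refine IsTraceClass.of_denumerable (ι := ℕ ⊕ ℕ) (Sum.elim x x') (Sum.elim y y') ?_ ?_
    · exact (HasSum.sum (f := fun i => ‖Sum.elim x x' i‖ * ‖Sum.elim y y' i‖)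
        hs.hasSum hs'.hasSum).summable
    · exact HasSum.sum (f := fun i => InnerProductSpace.rankOne ℂ (Sum.elim x x' i)
        (Sum.elim y y' i)) hS hT
  smul_mem' := by
    rintro c T ⟨x, y, hs, hT⟩
    refine ⟨fun n => c • x n, y, ?_, ?_⟩
    · simpa [norm_smul, mul_assoc] using hs.mul_left ‖c‖
    · simpa using hT.const_smul c

/-- The trace `∑ᵢ ⟨bᵢ, T bᵢ⟩` over an orthonormal basis `(bᵢ)` of `H`. For a trace class operator
the sum converges absolutely and does not depend on the basis, so one basis is fixed. -/
def trace {H : Type*} [NormedAddCommGroup H] [InnerProductSpace ℂ H] [CompleteSpace H]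
    (T : traceClass H) : ℂ :=
  ∑' i, ⟪(exists_hilbertBasis ℂ H).choose_spec.choose i,
    (T : H →L[ℂ] H) ((exists_hilbertBasis ℂ H).choose_spec.choose i)⟫_ℂ

/-- The rank one operator `|φ⟩⟨ψ|` as an element of `𝔗(H)`. -/
def ketBra {H : Type*} [NormedAddCommGroup H] [InnerProductSpace ℂ H] (φ ψ : H) : traceClass H :=
  ⟨InnerProductSpace.rankOne ℂ φ ψ, isTraceClass_rankOne φ ψ⟩

/-- Complete positivity of a linear map `Φ : 𝔗(A) → 𝔗(B)`: for every `n`, if the block operator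
`(T i j)` on `Aⁿ` with entries in `𝔗(A)` is positive, then so is the block operator `(Φ (T i j))`
on `Bⁿ`. Positivity of a block operator is positivity of its quadratic form. -/
def IsCompletelyPositive {A B : Type*} [NormedAddCommGroup A] [InnerProductSpace ℂ A]
    [NormedAddCommGroup B] [InnerProductSpace ℂ B] (Φ : traceClass A →ₗ[ℂ] traceClass B) : Prop :=
  ∀ (n : ℕ) (T : Fin n → Fin n → traceClass A),
    (∀ x : Fin n → A, 0 ≤ ∑ i, ∑ j, ⟪x i, (T i j : A →L[ℂ] A) (x j)⟫_ℂ) →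
    ∀ y : Fin n → B, 0 ≤ ∑ i, ∑ j, ⟪y i, (Φ (T i j) : B →L[ℂ] B) (y j)⟫_ℂ

/-- A quantum channel `𝔗(A) → 𝔗(B)`: a completely positive trace preserving linear map. -/
structure QuantumChannel (A B : Type*) [NormedAddCommGroup A] [InnerProductSpace ℂ A]
    [CompleteSpace A] [NormedAddCommGroup B] [InnerProductSpace ℂ B] [CompleteSpace B] where
  toLinearMap : traceClass A →ₗ[ℂ] traceClass B
  completelyPositive : IsCompletelyPositive toLinearMap
  tracePreserving : ∀ T, trace (toLinearMap T) = trace T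

/-! ### Tensor products -/

/-- The Hilbert space tensor product. -/
abbrev HilbertTensor (A C : Type*) [NormedAddCommGroup A] [InnerProductSpace ℂ A]
    [NormedAddCommGroup C] [InnerProductSpace ℂ C] : Type _ :=
  UniformSpace.Completion (A ⊗[ℂ] C)

/-- The elementary tensor `a ⊗ c` in the Hilbert space tensor product. -/
def elemTensor {A C : Type*} [NormedAddCommGroup A] [InnerProductSpace ℂ A]
    [NormedAddCommGroup C] [InnerProductSpace ℂ C] (a : A) (c : C) : HilbertTensor A C :=
  ((a ⊗ₜ[ℂ] c : A ⊗[ℂ] C) : UniformSpace.Completion (A ⊗[ℂ] C))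

/-- The tensor product `S ⊗ T` of bounded operators, acting on the Hilbert space tensor product;
`(S ⊗ T) (a ⊗ c) = S a ⊗ T c`. -/
def opTensor {A C : Type*} [NormedAddCommGroup A] [InnerProductSpace ℂ A]
    [NormedAddCommGroup C] [InnerProductSpace ℂ C] (S : A →L[ℂ] A) (T : C →L[ℂ] C) :
    HilbertTensor A C →L[ℂ] HilbertTensor A C :=
  (TensorProduct.mapL S T).completion

theorem opTensor_elemTensor {A C : Type*} [NormedAddCommGroup A] [InnerProductSpace ℂ A]
    [NormedAddCommGroup C] [InnerProductSpace ℂ C] (S : A →L[ℂ] A) (T : C →L[ℂ] C) (a : A)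
    (c : C) : opTensor S T (elemTensor a c) = elemTensor (S a) (T c) := by
  simp [opTensor, elemTensor]

theorem norm_elemTensor {A C : Type*} [NormedAddCommGroup A] [InnerProductSpace ℂ A]
    [NormedAddCommGroup C] [InnerProductSpace ℂ C] (a : A) (c : C) :
    ‖elemTensor a c‖ = ‖a‖ * ‖c‖ := by
  rw [elemTensor, UniformSpace.Completion.norm_coe, TensorProduct.norm_tmul]

theorem inner_elemTensor {A C : Type*} [NormedAddCommGroup A] [InnerProductSpace ℂ A]
    [NormedAddCommGroup C] [InnerProductSpace ℂ C] (a a' : A) (c c' : C) :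
    ⟪elemTensor a c, elemTensor a' c'⟫_ℂ = ⟪a, a'⟫_ℂ * ⟪c, c'⟫_ℂ := by
  rw [elemTensor, elemTensor, UniformSpace.Completion.inner_coe, TensorProduct.inner_tmul]

theorem elemTensor_add_left {A C : Type*} [NormedAddCommGroup A] [InnerProductSpace ℂ A]
    [NormedAddCommGroup C] [InnerProductSpace ℂ C] (a a' : A) (c : C) :
    elemTensor (a + a') c = elemTensor a c + elemTensor a' c := by
  rw [elemTensor, TensorProduct.add_tmul, UniformSpace.Completion.coe_add]; rfl

theorem elemTensor_add_right {A C : Type*} [NormedAddCommGroup A] [InnerProductSpace ℂ A]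
    [NormedAddCommGroup C] [InnerProductSpace ℂ C] (a : A) (c c' : C) :
    elemTensor a (c + c') = elemTensor a c + elemTensor a c' := by
  rw [elemTensor, TensorProduct.tmul_add, UniformSpace.Completion.coe_add]; rfl

theorem elemTensor_smul_left {A C : Type*} [NormedAddCommGroup A] [InnerProductSpace ℂ A]
    [NormedAddCommGroup C] [InnerProductSpace ℂ C] (r : ℂ) (a : A) (c : C) :
    elemTensor (r • a) c = r • elemTensor a c := by
  rw [elemTensor, ← TensorProduct.smul_tmul', UniformSpace.Completion.coe_smul]; rfl

theorem elemTensor_smul_right {A C : Type*} [NormedAddCommGroup A] [InnerProductSpace ℂ A]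
    [NormedAddCommGroup C] [InnerProductSpace ℂ C] (r : ℂ) (a : A) (c : C) :
    elemTensor a (r • c) = r • elemTensor a c := by
  rw [elemTensor, TensorProduct.tmul_smul, UniformSpace.Completion.coe_smul]; rfl

theorem opTensor_ext {A C : Type*} [NormedAddCommGroup A] [InnerProductSpace ℂ A]
    [NormedAddCommGroup C] [InnerProductSpace ℂ C]
    {U V : HilbertTensor A C →L[ℂ] HilbertTensor A C}
    (h : ∀ a c, U (elemTensor a c) = V (elemTensor a c)) : U = V := by
  ext z
  induction z using UniformSpace.Completion.induction_on with
  | hp => exact isClosed_eq U.continuous V.continuous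
  | ih z =>
    induction z using TensorProduct.induction_on with
    | zero => rw [UniformSpace.Completion.coe_zero, map_zero, map_zero]
    | tmul a c => exact h a c
    | add z w hz hw => rw [UniformSpace.Completion.coe_add, map_add, map_add, hz, hw]

theorem norm_opTensor_le {A C : Type*} [NormedAddCommGroup A] [InnerProductSpace ℂ A]
    [NormedAddCommGroup C] [InnerProductSpace ℂ C] (S : A →L[ℂ] A) (T : C →L[ℂ] C) :
    ‖opTensor S T‖ ≤ ‖S‖ * ‖T‖ := by
  refine ContinuousLinearMap.opNorm_le_bound _ (by positivity) fun z => ?_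
  induction z using UniformSpace.Completion.induction_on with
  | hp =>
    exact isClosed_le (opTensor S T).continuous.norm (continuous_const.mul continuous_norm)
  | ih z =>
    rw [opTensor, ContinuousLinearMap.completion_apply_coe, UniformSpace.Completion.norm_coe,
      UniformSpace.Completion.norm_coe]
    exact (ContinuousLinearMap.le_opNorm _ _).trans
      (mul_le_mul_of_nonneg_right (TensorProduct.norm_mapL_le S T) (norm_nonneg z))

theorem hasSum_opTensor_left {A C : Type*} [NormedAddCommGroup A] [InnerProductSpace ℂ A]
    [NormedAddCommGroup C] [InnerProductSpace ℂ C] {f : ℕ → A →L[ℂ] A} {S : A →L[ℂ] A}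
    (hf : HasSum f S) (T : C →L[ℂ] C) : HasSum (fun n => opTensor (f n) T) (opTensor S T) := by
  let L : (A →L[ℂ] A) →ₗ[ℂ] (HilbertTensor A C →L[ℂ] HilbertTensor A C) :=
    { toFun := fun R => opTensor R T
      map_add' := fun R R' => opTensor_ext fun a c => by
        rw [add_apply]
        simp only [opTensor_elemTensor, add_apply, elemTensor_add_left]
      map_smul' := fun r R => opTensor_ext fun a c => by
        rw [smul_apply]
        simp only [opTensor_elemTensor, smul_apply, elemTensor_smul_left, RingHom.id_apply] }
  have hL : Continuous L := AddMonoidHomClass.continuous_of_bound L ‖T‖ fun R => by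
    rw [mul_comm]; exact norm_opTensor_le R T
  exact hf.map L hL

theorem hasSum_opTensor_right {A C : Type*} [NormedAddCommGroup A] [InnerProductSpace ℂ A]
    [NormedAddCommGroup C] [InnerProductSpace ℂ C] {f : ℕ → C →L[ℂ] C} {T : C →L[ℂ] C}
    (S : A →L[ℂ] A) (hf : HasSum f T) : HasSum (fun n => opTensor S (f n)) (opTensor S T) := by
  let L : (C →L[ℂ] C) →ₗ[ℂ] (HilbertTensor A C →L[ℂ] HilbertTensor A C) :=
    { toFun := fun R => opTensor S R
      map_add' := fun R R' => opTensor_ext fun a c => by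
        rw [add_apply]
        simp only [opTensor_elemTensor, add_apply, elemTensor_add_right]
      map_smul' := fun r R => opTensor_ext fun a c => by
        rw [smul_apply]
        simp only [opTensor_elemTensor, smul_apply, elemTensor_smul_right, RingHom.id_apply] }
  have hL : Continuous L := AddMonoidHomClass.continuous_of_bound L ‖S‖ fun R => norm_opTensor_le S R
  exact hf.map L hL

theorem opTensor_rankOne {A C : Type*} [NormedAddCommGroup A] [InnerProductSpace ℂ A]
    [NormedAddCommGroup C] [InnerProductSpace ℂ C] (x y : A) (u v : C) :
    opTensor (InnerProductSpace.rankOne ℂ x y) (InnerProductSpace.rankOne ℂ u v) =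
      InnerProductSpace.rankOne ℂ (elemTensor x u) (elemTensor y v) := by
  refine opTensor_ext fun a c => ?_
  rw [opTensor_elemTensor, InnerProductSpace.rankOne_apply, InnerProductSpace.rankOne_apply,
    InnerProductSpace.rankOne_apply, inner_elemTensor, elemTensor_smul_left,
    elemTensor_smul_right, smul_smul]

theorem IsTraceClass.opTensor {A C : Type*} [NormedAddCommGroup A] [InnerProductSpace ℂ A]
    [NormedAddCommGroup C] [InnerProductSpace ℂ C] {S : A →L[ℂ] A} {T : C →L[ℂ] C}
    (hS : IsTraceClass S) (hT : IsTraceClass T) :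
    IsTraceClass (QuantumReversibility.opTensor S T) := by
  obtain ⟨x, y, hxy, hS⟩ := hS
  obtain ⟨u, v, huv, hT⟩ := hT
  have hs : Summable (fun p : ℕ × ℕ =>
      ‖elemTensor (x p.1) (u p.2)‖ * ‖elemTensor (y p.1) (v p.2)‖) := by
    refine (hxy.mul_of_nonneg huv (fun n => by positivity) (fun n => by positivity)).congr
      fun p => ?_
    rw [norm_elemTensor, norm_elemTensor]; ring
  refine IsTraceClass.of_denumerable (fun p : ℕ × ℕ => elemTensor (x p.1) (u p.2))
    (fun p => elemTensor (y p.1) (v p.2)) hs ?_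
  have hsum : Summable (fun p : ℕ × ℕ => InnerProductSpace.rankOne ℂ
      (elemTensor (x p.1) (u p.2)) (elemTensor (y p.1) (v p.2))) :=
    Summable.of_norm (by simpa using hs)
  have hrow : ∀ n, HasSum (fun m => InnerProductSpace.rankOne ℂ
      (elemTensor (x n) (u m)) (elemTensor (y n) (v m)))
      (QuantumReversibility.opTensor (InnerProductSpace.rankOne ℂ (x n) (y n)) T) := fun n => by
    have h := hasSum_opTensor_right (InnerProductSpace.rankOne ℂ (x n) (y n)) hT
    simpa only [opTensor_rankOne] using h
  have h4 := hsum.hasSum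
  rw [(hsum.hasSum.prod_fiberwise hrow).unique (hasSum_opTensor_left hS T)] at h4
  exact h4

/-- The tensor product `ρ ⊗ σ` of trace class operators. -/
def traceClassTensor {A C : Type*} [NormedAddCommGroup A] [InnerProductSpace ℂ A]
    [NormedAddCommGroup C] [InnerProductSpace ℂ C] (ρ : traceClass A) (σ : traceClass C) :
    traceClass (HilbertTensor A C) :=
  ⟨opTensor (ρ : A →L[ℂ] A) (σ : C →L[ℂ] C), ρ.2.opTensor σ.2⟩

/-- `Θ` is the tensor product channel `Φ ⊗ Ψ`: the channel with `Θ (ρ ⊗ σ) = Φ ρ ⊗ Ψ σ` for all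
trace class operators `ρ` and `σ`. -/
def IsTensorChannel {A B C D : Type*}
    [NormedAddCommGroup A] [InnerProductSpace ℂ A] [CompleteSpace A]
    [NormedAddCommGroup B] [InnerProductSpace ℂ B] [CompleteSpace B]
    [NormedAddCommGroup C] [InnerProductSpace ℂ C] [CompleteSpace C]
    [NormedAddCommGroup D] [InnerProductSpace ℂ D] [CompleteSpace D]
    (Φ : QuantumChannel A B) (Ψ : QuantumChannel C D)
    (Θ : QuantumChannel (HilbertTensor A C) (HilbertTensor B D)) : Prop :=
  ∀ (ρ : traceClass A) (σ : traceClass C),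
    Θ.toLinearMap (traceClassTensor ρ σ) =
      traceClassTensor (Φ.toLinearMap ρ) (Ψ.toLinearMap σ)

/-! ### Families of pure states and reversibility -/

/-- A family of pure states: each member is `|φ⟩⟨φ|` for a unit vector `φ`. -/
def IsPureFamily {H : Type*} [NormedAddCommGroup H] [InnerProductSpace ℂ H]
    (S : Set (traceClass H)) : Prop :=
  ∀ ρ ∈ S, ∃ φ : H, ‖φ‖ = 1 ∧ ρ = ketBra φ φ

/-- A family of pure states `|φ⟩⟨φ|` is complete if the linear hull of the vectors `φ` is dense. -/
def IsCompleteFamily {H : Type*} [NormedAddCommGroup H] [InnerProductSpace ℂ H]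
    (S : Set (traceClass H)) : Prop :=
  Dense (Submodule.span ℂ {φ : H | ‖φ‖ = 1 ∧ ketBra φ φ ∈ S} : Set H)

/-- An orthogonal family: any two different members `|φ⟩⟨φ|`, `|ψ⟩⟨ψ|` satisfy `⟨φ, ψ⟩ = 0`. -/
def IsOrthogonalFamily {H : Type*} [NormedAddCommGroup H] [InnerProductSpace ℂ H]
    (S : Set (traceClass H)) : Prop :=
  ∀ φ ψ : H, ‖φ‖ = 1 → ‖ψ‖ = 1 → ketBra φ φ ∈ S → ketBra ψ ψ ∈ S →
    ketBra φ φ ≠ ketBra ψ ψ → ⟪φ, ψ⟫_ℂ = 0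

/-- A nonorthogonal family: its members are mutually nonorthogonal, that is any two members
`|φ⟩⟨φ|` and `|ψ⟩⟨ψ|` satisfy `⟨φ, ψ⟩ ≠ 0`. -/
def IsNonorthogonalFamily {H : Type*} [NormedAddCommGroup H] [InnerProductSpace ℂ H]
    (S : Set (traceClass H)) : Prop :=
  ∀ φ ψ : H, ‖φ‖ = 1 → ‖ψ‖ = 1 → ketBra φ φ ∈ S → ketBra ψ ψ ∈ S → ⟪φ, ψ⟫_ℂ ≠ 0

/-- The channel `Φ` is reversible with respect to the family `S`: some channel `Λ` satisfies
`Λ (Φ ρ) = ρ` for every `ρ ∈ S`. -/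
def IsReversible {A B : Type*}
    [NormedAddCommGroup A] [InnerProductSpace ℂ A] [CompleteSpace A]
    [NormedAddCommGroup B] [InnerProductSpace ℂ B] [CompleteSpace B]
    (Φ : QuantumChannel A B) (S : Set (traceClass A)) : Prop :=
  ∃ Λ : QuantumChannel B A, ∀ ρ ∈ S, Λ.toLinearMap (Φ.toLinearMap ρ) = ρ

/-- `Φ` is reversible with respect to some complete family of pure states. -/
def ReversibleComplete {A B : Type*}
    [NormedAddCommGroup A] [InnerProductSpace ℂ A] [CompleteSpace A]
    [NormedAddCommGroup B] [InnerProductSpace ℂ B] [CompleteSpace B]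
    (Φ : QuantumChannel A B) : Prop :=
  ∃ S : Set (traceClass A), IsPureFamily S ∧ IsCompleteFamily S ∧ IsReversible Φ S

/-- `Φ` is reversible with respect to some complete orthogonal family of pure states. -/
def ReversibleCompleteOrthogonal {A B : Type*}
    [NormedAddCommGroup A] [InnerProductSpace ℂ A] [CompleteSpace A]
    [NormedAddCommGroup B] [InnerProductSpace ℂ B] [CompleteSpace B]
    (Φ : QuantumChannel A B) : Prop :=
  ∃ S : Set (traceClass A),
    IsPureFamily S ∧ IsCompleteFamily S ∧ IsOrthogonalFamily S ∧ IsReversible Φ S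

/-- `Φ` is reversible with respect to some complete nonorthogonal family of pure states. -/
def ReversibleCompleteNonorthogonal {A B : Type*}
    [NormedAddCommGroup A] [InnerProductSpace ℂ A] [CompleteSpace A]
    [NormedAddCommGroup B] [InnerProductSpace ℂ B] [CompleteSpace B]
    (Φ : QuantumChannel A B) : Prop :=
  ∃ S : Set (traceClass A),
    IsPureFamily S ∧ IsCompleteFamily S ∧ IsNonorthogonalFamily S ∧ IsReversible Φ S

/-- `HasRi₁ Φ k` says that the first component `ri₁(Φ)` of the reversibility index is `k`. At most
one `k` has this property, by the shape of the three clauses. -/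
def HasRi₁ {A B : Type*}
    [NormedAddCommGroup A] [InnerProductSpace ℂ A] [CompleteSpace A]
    [NormedAddCommGroup B] [InnerProductSpace ℂ B] [CompleteSpace B]
    (Φ : QuantumChannel A B) : ℕ → Prop
  | 0 => ¬ ReversibleComplete Φ
  | 1 => ReversibleCompleteOrthogonal Φ ∧ ¬ ReversibleCompleteNonorthogonal Φ
  | 2 => ReversibleCompleteNonorthogonal Φ
  | _ => False

theorem HasRi₁.unique {A B : Type*}
    [NormedAddCommGroup A] [InnerProductSpace ℂ A] [CompleteSpace A]
    [NormedAddCommGroup B] [InnerProductSpace ℂ B] [CompleteSpace B]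
    {Φ : QuantumChannel A B} {k l : ℕ} (hk : HasRi₁ Φ k) (hl : HasRi₁ Φ l) : k = l := by
  have h1 : ReversibleCompleteOrthogonal Φ → ReversibleComplete Φ :=
    fun ⟨S, h, h', _, h''⟩ => ⟨S, h, h', h''⟩
  have h2 : ReversibleCompleteNonorthogonal Φ → ReversibleComplete Φ :=
    fun ⟨S, h, h', _, h''⟩ => ⟨S, h, h', h''⟩
  match k, l with
  | 0, 0 | 1, 1 | 2, 2 => rfl
  | 0, 1 => exact absurd (h1 hl.1) hk
  | 0, 2 => exact absurd (h2 hl) hk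
  | 1, 0 => exact absurd (h1 hk.1) hl
  | 1, 2 => exact absurd hl hk.2
  | 2, 0 => exact absurd (h2 hk) hl
  | 2, 1 => exact absurd hk hl.2
  | _ + 3, _ => exact hk.elim
  | _, _ + 3 => exact hl.elim

end QuantumReversibility

end

noncomputable section

namespace QuantumReversibility

open InnerProductSpace ContinuousLinearMap

universe u v w

/-! ### Series of rank one operators and the trace -/

/-! Every channel has the form `T ↦ ∑ₖ V k T (V k)†` (`QuantumChannel.exists_kraus`), and both kinds
of reversibility can be read off from the operators `V k`.

Suppose `Λ`, with Kraus operators `W m`, restores the pure states of a complete family. A pure state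
is extreme, so each `W m (V k φ)` is a multiple of `φ`, and nonorthogonal members share these
multipliers (`IsKraus.eigenvalue_eq`). Hence every member is a joint eigenvector of all `(V k)† (V
l)` (`IsKraus.dense_jointEigenvector`). Conversely, if the joint eigenvectors span densely, there is
an orthonormal basis of them. Its elements have mutually orthogonal images under the channel, so
measuring which image occurred and preparing the corresponding basis vector reverses the channel
(`IsKraus.reversibleCompleteOrthogonal`). Reversibility on some complete family is therefore the
same as reversibility on a complete orthogonal one, which gives the trichotomy.

If the family is nonorthogonal, the multipliers are the same for all members, so each `W m ∘ V k` is
a scalar and `Λ` inverts the channel on all states. Conversely such scalars suffice, because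
complete nonorthogonal families always exist.

Both criteria are compatible with tensor products. Joint eigenvectors of the factors multiply, and
contracting a joint eigenvector of `V ⊗ W` with a vector of one factor gives a joint eigenvector of
the other family (`IsHilbertTensor.dense_jointEigenvector_left`). Left inverses multiply as well;
one for the product restricts to a factor by feeding in a fixed state of the other factor and
tracing it out (`IsHilbertTensor.exists_scalar_left`). So each kind of reversibility holds for the
product exactly when it holds for both factors, which is the formula with `min`. -/

theorem isTraceClass_of_hasSum {H : Type*} [NormedAddCommGroup H] [InnerProductSpace ℂ H]
    {ι : Type*} {T : H →L[ℂ] H} {x y : ι → H} (hs : Summable (fun i => ‖x i‖ * ‖y i‖))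
    (hT : HasSum (fun i => rankOne ℂ (x i) (y i)) T) : IsTraceClass T := by
  classical
  set S : Set ι := Function.support (fun i => ‖x i‖ * ‖y i‖) with hS
  have hc : Countable S := hs.countable_support
  have hzero : ∀ i ∉ S, rankOne ℂ (x i) (y i) = 0 := by
    intro i hi
    have h0 : ‖x i‖ * ‖y i‖ = 0 := Function.notMem_support.mp hi
    rw [← norm_eq_zero, norm_rankOne, h0]
  have hsub : HasSum ((fun i => rankOne ℂ (x i) (y i)) ∘ (Subtype.val : S → ι)) T := by
    refine (hasSum_subtype_iff_of_support_subset fun i hi => ?_).mpr hT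
    by_contra h
    exact hi (hzero i h)
  -- Zero terms indexed by `ℕ` make the index set infinite even when `S` is finite.
  obtain ⟨_⟩ := nonempty_denumerable (S ⊕ ℕ)
  refine IsTraceClass.of_denumerable (ι := S ⊕ ℕ) (Sum.elim (fun i => x i) fun _ => 0)
    (Sum.elim (fun i => y i) fun _ => 0) ?_ ?_
  · exact (HasSum.sum (f := fun i => ‖Sum.elim (fun i : S => x i) (fun _ : ℕ => 0) i‖ *
      ‖Sum.elim (fun i : S => y i) (fun _ : ℕ => 0) i‖)
      (hs.subtype S).hasSum
      (by simp only [Function.comp_def, Sum.elim_inr, norm_zero, mul_zero]; exact hasSum_zero)).summable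
  · have h := HasSum.sum (f := fun i => rankOne ℂ
      (Sum.elim (fun i : S => x i) (fun _ : ℕ => 0) i)
      (Sum.elim (fun i : S => y i) (fun _ : ℕ => 0) i)) (b := 0) hsub
      (by simp only [Function.comp_def, Sum.elim_inr, map_zero]; exact hasSum_zero)
    rwa [add_zero] at h

theorem summable_mul_of_hasSum_sq {ι : Type*} {f g : ι → ℝ} {a b : ℝ} (hf : ∀ i, 0 ≤ f i)
    (hg : ∀ i, 0 ≤ g i) (ha : 0 ≤ a) (hb : 0 ≤ b) (hfa : HasSum (fun i => f i ^ 2) (a ^ 2))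
    (hgb : HasSum (fun i => g i ^ 2) (b ^ 2)) :
    Summable (fun i => f i * g i) ∧ ∑' i, f i * g i ≤ a * b := by
  have h := Real.summable_and_inner_le_Lp_mul_Lq_tsum_of_nonneg (f := f) (g := g)
    Real.HolderConjugate.two_two hf hg (by simpa using hfa.summable) (by simpa using hgb.summable)
  refine ⟨h.1, h.2.trans_eq ?_⟩
  simp only [Real.rpow_two]
  rw [hfa.tsum_eq, hgb.tsum_eq, ← Real.sqrt_eq_rpow, ← Real.sqrt_eq_rpow, Real.sqrt_sq ha,
    Real.sqrt_sq hb]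

theorem hasSum_norm_inner_sq {H : Type*} [NormedAddCommGroup H] [InnerProductSpace ℂ H]
    {ι : Type*} (b : HilbertBasis ι ℂ H) (x : H) :
    HasSum (fun i => ‖⟪b i, x⟫_ℂ‖ ^ 2) (‖x‖ ^ 2) := by
  have h := b.hasSum_inner_mul_inner x x
  rw [inner_self_eq_norm_sq_to_K] at h
  have h2 : ∀ i, ⟪x, b i⟫_ℂ * ⟪b i, x⟫_ℂ = ((‖⟪b i, x⟫_ℂ‖ ^ 2 : ℝ) : ℂ) := fun i => by
    rw [← inner_conj_symm, RCLike.conj_mul]; simp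
  simp only [h2] at h
  exact Complex.hasSum_ofReal.mp (by simpa using h)

/-- Fubini for a doubly indexed family dominated by a product of square summable rows. -/
theorem summable_prod_mul_of_hasSum_sq {ι κ : Type*} {f g : κ × ι → ℝ} {a b : κ → ℝ}
    (hf : ∀ p, 0 ≤ f p) (hg : ∀ p, 0 ≤ g p) (ha : ∀ n, 0 ≤ a n) (hb : ∀ n, 0 ≤ b n)
    (hfa : ∀ n, HasSum (fun i => f (n, i) ^ 2) (a n ^ 2))
    (hgb : ∀ n, HasSum (fun i => g (n, i) ^ 2) (b n ^ 2)) (hs : Summable (fun n => a n * b n)) :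
    Summable (fun p => f p * g p) := by
  have h := fun n => summable_mul_of_hasSum_sq (fun i => hf (n, i)) (fun i => hg (n, i)) (ha n)
    (hb n) (hfa n) (hgb n)
  refine (summable_prod_of_nonneg fun p => mul_nonneg (hf p) (hg p)).mpr ⟨fun n => (h n).1, ?_⟩
  exact hs.of_nonneg_of_le (fun n => tsum_nonneg fun i => mul_nonneg (hf _) (hg _))
    fun n => (h n).2

/-- Parseval expands each `⟪y n, x n⟫` over the basis, and the double series converges absolutely,
so it can be summed in either order. The value does not involve `b`: the trace is independent of the
basis. -/
theorem hasSum_inner_basis {H : Type*} [NormedAddCommGroup H] [InnerProductSpace ℂ H]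
    {ι κ : Type*} (b : HilbertBasis ι ℂ H) {T : H →L[ℂ] H} {x y : κ → H}
    (hs : Summable (fun n => ‖x n‖ * ‖y n‖))
    (hT : HasSum (fun n => rankOne ℂ (x n) (y n)) T) :
    HasSum (fun i => ⟪b i, T (b i)⟫_ℂ) (∑' n, ⟪y n, x n⟫_ℂ) := by
  have hsum : Summable (fun p : κ × ι => ⟪y p.1, b p.2⟫_ℂ * ⟪b p.2, x p.1⟫_ℂ) := by
    refine Summable.of_norm ?_
    have := summable_prod_mul_of_hasSum_sq (f := fun p : κ × ι => ‖⟪b p.2, x p.1⟫_ℂ‖)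
      (g := fun p => ‖⟪b p.2, y p.1⟫_ℂ‖) (a := fun n => ‖x n‖) (b := fun n => ‖y n‖)
      (fun _ => norm_nonneg _) (fun _ => norm_nonneg _) (fun _ => norm_nonneg _)
      (fun _ => norm_nonneg _) (fun n => hasSum_norm_inner_sq b (x n))
      (fun n => hasSum_norm_inner_sq b (y n)) hs
    refine this.congr fun p => ?_
    rw [norm_mul, mul_comm, norm_inner_symm (y p.1)]
  have h1 := hsum.hasSum.prod_fiberwise fun n => b.hasSum_inner_mul_inner (y n) (x n)
  have h2 := ((Equiv.prodComm ι κ).hasSum_iff.mpr hsum.hasSum).prod_fiberwise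
    (g := fun i => ⟪b i, T (b i)⟫_ℂ) fun i => by
      have := (hT.mapL (ContinuousLinearMap.apply ℂ H (b i))).mapL (innerSL ℂ (b i))
      simpa [inner_smul_right] using this
  rwa [h1.tsum_eq]

theorem hasSum_trace {H : Type*} [NormedAddCommGroup H] [InnerProductSpace ℂ H] [CompleteSpace H]
    {κ : Type*} {T : traceClass H} {x y : κ → H} (hs : Summable (fun n => ‖x n‖ * ‖y n‖))
    (hT : HasSum (fun n => rankOne ℂ (x n) (y n)) (T : H →L[ℂ] H)) :
    HasSum (fun n => ⟪y n, x n⟫_ℂ) (trace T) := by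
  rw [trace, (hasSum_inner_basis _ hs hT).tsum_eq]
  refine (Summable.of_norm_bounded hs fun n => ?_).hasSum
  rw [mul_comm]
  exact norm_inner_le_norm _ _

theorem hasSum_inner_self_trace {H : Type*} [NormedAddCommGroup H] [InnerProductSpace ℂ H]
    [CompleteSpace H] {ι : Type*} (b : HilbertBasis ι ℂ H) (T : traceClass H) :
    HasSum (fun i => ⟪b i, (T : H →L[ℂ] H) (b i)⟫_ℂ) (trace T) := by
  obtain ⟨x, y, hs, hT⟩ := T.2
  rw [← (hasSum_trace hs hT).tsum_eq]
  exact hasSum_inner_basis b hs hT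

theorem trace_sub {H : Type*} [NormedAddCommGroup H] [InnerProductSpace ℂ H] [CompleteSpace H]
    (S T : traceClass H) : trace (S - T) = trace S - trace T := by
  obtain ⟨w, b, -⟩ := exists_hilbertBasis ℂ H
  refine (hasSum_inner_self_trace b (S - T)).unique ?_
  simpa [inner_sub_right] using (hasSum_inner_self_trace b S).sub (hasSum_inner_self_trace b T)

theorem trace_ketBra {H : Type*} [NormedAddCommGroup H] [InnerProductSpace ℂ H] [CompleteSpace H]
    (x y : H) : trace (ketBra x y) = ⟪y, x⟫_ℂ :=
  (hasSum_trace (κ := Unit) (T := ketBra x y) (x := fun _ => x) (y := fun _ => y)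
    Summable.of_finite (hasSum_unique _)).unique (hasSum_unique (fun _ : Unit => ⟪y, x⟫_ℂ))

theorem hasSum_inner_of_hasSum_rankOne {H : Type*} [NormedAddCommGroup H] [InnerProductSpace ℂ H]
    {κ : Type*} {T : H →L[ℂ] H} {x y : κ → H}
    (hT : HasSum (fun n => rankOne ℂ (x n) (y n)) T) (z z' : H) :
    HasSum (fun n => ⟪z, x n⟫_ℂ * ⟪y n, z'⟫_ℂ) ⟪z, T z'⟫_ℂ := by
  have := (hT.mapL (ContinuousLinearMap.apply ℂ H z')).mapL (innerSL ℂ z)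
  simpa [inner_smul_right, mul_comm] using this

theorem traceClass_ext {H : Type*} [NormedAddCommGroup H] [InnerProductSpace ℂ H]
    {S T : traceClass H}
    (h : ∀ z z', ⟪z, (S : H →L[ℂ] H) z'⟫_ℂ = ⟪z, (T : H →L[ℂ] H) z'⟫_ℂ) : S = T :=
  Subtype.ext (ContinuousLinearMap.ext fun z' => ext_inner_left ℂ fun z => h z z')

/-! ### Channels given by Kraus operators -/

/-- A family of operators `V k : A → B` with `∑ₖ ‖V k a‖² = ‖a‖²` for every `a`. -/
def IsKraus {A B ι : Type*} [NormedAddCommGroup A] [InnerProductSpace ℂ A]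
    [NormedAddCommGroup B] [InnerProductSpace ℂ B] (V : ι → A →L[ℂ] B) : Prop :=
  ∀ a, HasSum (fun k => ‖V k a‖ ^ 2) (‖a‖ ^ 2)

section Kraus

variable {A B ι : Type*} [NormedAddCommGroup A] [InnerProductSpace ℂ A]
  [NormedAddCommGroup B] [InnerProductSpace ℂ B] {V : ι → A →L[ℂ] B}

theorem IsKraus.hasSum_inner (h : IsKraus V) (a a' : A) :
    HasSum (fun k => ⟪V k a, V k a'⟫_ℂ) ⟪a, a'⟫_ℂ := by
  have h' : ∀ a, HasSum (fun k => (‖V k a‖ : ℂ) ^ 2) ((‖a‖ : ℂ) ^ 2) := fun a => by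
    exact_mod_cast Complex.hasSum_ofReal.mpr (h a)
  simp only [inner_eq_sum_norm_sq_div_four (𝕜 := ℂ), ← map_add, ← map_sub, ← map_smul]
  exact (((h' _).sub (h' _)).add (((h' _).sub (h' _)).mul_right _)).div_const _

theorem IsKraus.summable_norm_mul_norm (h : IsKraus V) {κ : Type*} {x y : κ → A}
    (hs : Summable (fun n => ‖x n‖ * ‖y n‖)) :
    Summable (fun p : κ × ι => ‖V p.2 (x p.1)‖ * ‖V p.2 (y p.1)‖) :=
  summable_prod_mul_of_hasSum_sq (f := fun p : κ × ι => ‖V p.2 (x p.1)‖)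
    (g := fun p => ‖V p.2 (y p.1)‖) (fun _ => norm_nonneg _) (fun _ => norm_nonneg _)
    (fun _ => norm_nonneg _) (fun _ => norm_nonneg _) (fun n => h (x n)) (fun n => h (y n)) hs

variable [CompleteSpace A] [CompleteSpace B]

/-- Each term `|x⟩⟨y|` of `T` is sent to `∑ₖ |V k x⟩⟨V k y|`. The matrix elements determine `R`
whatever decomposition of `T` was used, which is why the choice made in `IsKraus.channel` is linear.
-/
theorem IsKraus.exists_traceClass (h : IsKraus V) (T : traceClass A) :
    ∃ R : traceClass B, (∀ z z', HasSum (fun k => ⟪adjoint (V k) z,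
      (T : A →L[ℂ] A) (adjoint (V k) z')⟫_ℂ) ⟪z, (R : B →L[ℂ] B) z'⟫_ℂ) ∧ trace R = trace T := by
  obtain ⟨x, y, hs, hT⟩ := T.2
  have hs2 := h.summable_norm_mul_norm hs
  have hsum : Summable (fun p : ℕ × ι => rankOne ℂ (V p.2 (x p.1)) (V p.2 (y p.1))) :=
    Summable.of_norm (by simpa using hs2)
  obtain ⟨R, hR⟩ := hsum
  refine ⟨⟨R, isTraceClass_of_hasSum hs2 hR⟩, fun z z' => ?_, ?_⟩
  · have h1 := hasSum_inner_of_hasSum_rankOne hR z z'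
    refine ((Equiv.prodComm ι ℕ).hasSum_iff.mpr h1).prod_fiberwise fun k => ?_
    have h2 := hasSum_inner_of_hasSum_rankOne hT (adjoint (V k) z) (adjoint (V k) z')
    simpa [adjoint_inner_left, adjoint_inner_right] using h2
  · have h1 := hasSum_trace (T := ⟨R, isTraceClass_of_hasSum hs2 hR⟩) hs2 hR
    have h2 := h1.prod_fiberwise fun n => h.hasSum_inner (y n) (x n)
    exact h2.unique (hasSum_trace hs hT)

/-- The channel `T ↦ ∑ₖ V k T (V k)†`. -/
def IsKraus.channel (h : IsKraus V) : QuantumChannel A B where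
  toLinearMap :=
    { toFun := fun T => (h.exists_traceClass T).choose
      map_add' := fun S T => traceClass_ext fun z z' => by
        refine ((h.exists_traceClass (S + T)).choose_spec.1 z z').unique ?_
        simpa [inner_add_right] using ((h.exists_traceClass S).choose_spec.1 z z').add
          ((h.exists_traceClass T).choose_spec.1 z z')
      map_smul' := fun c T => traceClass_ext fun z z' => by
        refine ((h.exists_traceClass (c • T)).choose_spec.1 z z').unique ?_
        simpa [inner_smul_right] using ((h.exists_traceClass T).choose_spec.1 z z').mul_left c }
  completelyPositive := fun n T hT y => by
    refine (hasSum_sum fun i _ => hasSum_sum fun j _ =>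
      (h.exists_traceClass (T i j)).choose_spec.1 (y i) (y j)).nonneg fun k => ?_
    exact hT fun i => adjoint (V k) (y i)
  tracePreserving := fun T => (h.exists_traceClass T).choose_spec.2

theorem IsKraus.hasSum_channel (h : IsKraus V) (T : traceClass A) (z z' : B) :
    HasSum (fun k => ⟪adjoint (V k) z, (T : A →L[ℂ] A) (adjoint (V k) z')⟫_ℂ)
      ⟪z, (h.channel.toLinearMap T : B →L[ℂ] B) z'⟫_ℂ :=
  (h.exists_traceClass T).choose_spec.1 z z'

theorem IsKraus.hasSum_channel_ketBra (h : IsKraus V) (x y : A) (z z' : B) :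
    HasSum (fun k => ⟪z, V k x⟫_ℂ * ⟪V k y, z'⟫_ℂ)
      ⟪z, (h.channel.toLinearMap (ketBra x y) : B →L[ℂ] B) z'⟫_ℂ := by
  have := h.hasSum_channel (ketBra x y) z z'
  simpa [ketBra, adjoint_inner_left, adjoint_inner_right, inner_smul_right, mul_comm] using this

end Kraus

/-! ### Continuity of channels -/

/-- With `Q = √T`, the trace of `T` is the squared Hilbert–Schmidt norm of `Q`, which dominates
`‖Q‖²`. Since channels preserve positivity and trace, this is the source of all their continuity
properties. -/
theorem norm_le_trace_of_nonneg {H : Type*} [NormedAddCommGroup H] [InnerProductSpace ℂ H]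
    [CompleteSpace H] (T : traceClass H) (hT : ∀ x, 0 ≤ ⟪x, (T : H →L[ℂ] H) x⟫_ℂ) :
    ‖(T : H →L[ℂ] H)‖ ≤ (trace T).re := by
  have hpos : 0 ≤ (T : H →L[ℂ] H) := by
    rw [ContinuousLinearMap.nonneg_iff_isPositive, ContinuousLinearMap.isPositive_iff_complex]
    intro x
    have h := hT x
    rw [← inner_conj_symm] at h
    have h' := Complex.nonneg_iff.mp h
    rw [Complex.conj_re, Complex.conj_im] at h'
    exact ⟨Complex.ext rfl (by simpa [eq_comm] using h'.2), h'.1⟩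
  set Q : H →L[ℂ] H := CFC.sqrt (T : H →L[ℂ] H) with hQ
  have hQQ : Q * Q = T := CFC.sqrt_mul_sqrt_self _ hpos
  have hQs : ∀ x y, ⟪Q x, y⟫_ℂ = ⟪x, Q y⟫_ℂ := fun x y => by
    have : IsSelfAdjoint Q := IsSelfAdjoint.of_nonneg (CFC.sqrt_nonneg _)
    rw [← ContinuousLinearMap.adjoint_inner_left, this.adjoint_eq]
  have hTQ : ∀ x y, ⟪x, (T : H →L[ℂ] H) y⟫_ℂ = ⟪Q x, Q y⟫_ℂ := fun x y => by
    rw [← hQQ, hQs]; rfl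
  obtain ⟨w, b, -⟩ := exists_hilbertBasis ℂ H
  have hb : HasSum (fun i => ‖Q (b i)‖ ^ 2) (trace T).re := by
    have := Complex.hasSum_re (hasSum_inner_self_trace b T)
    simpa only [hTQ, inner_self_eq_norm_sq_to_K, ← Complex.ofReal_pow, Complex.coe_algebraMap,
      Complex.ofReal_re] using this
  have htr : 0 ≤ (trace T).re := hb.nonneg fun _ => by positivity
  have hQn : ‖Q‖ ≤ √(trace T).re := by
    refine ContinuousLinearMap.opNorm_le_bound _ (Real.sqrt_nonneg _) fun v => ?_
    refine (sq_le_sq₀ (norm_nonneg _) (by positivity)).mp ?_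
    rw [mul_pow, Real.sq_sqrt htr]
    refine hasSum_le (fun i => ?_) (hasSum_norm_inner_sq b (Q v)) (hb.mul_right (‖v‖ ^ 2))
    rw [← hQs, ← mul_pow]
    exact pow_le_pow_left₀ (norm_nonneg _) (norm_inner_le_norm _ _) 2
  calc ‖(T : H →L[ℂ] H)‖ = ‖Q * Q‖ := by rw [hQQ]
    _ ≤ ‖Q‖ * ‖Q‖ := norm_mul_le _ _
    _ ≤ √(trace T).re * √(trace T).re := by gcongr
    _ = _ := Real.mul_self_sqrt htr

section Channel

variable {A B : Type*} [NormedAddCommGroup A] [InnerProductSpace ℂ A] [CompleteSpace A]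
  [NormedAddCommGroup B] [InnerProductSpace ℂ B] [CompleteSpace B]

theorem QuantumChannel.norm_le_of_nonneg (Φ : QuantumChannel A B) (T : traceClass A)
    (hT : ∀ x, 0 ≤ ⟪x, (T : A →L[ℂ] A) x⟫_ℂ) :
    ‖(Φ.toLinearMap T : B →L[ℂ] B)‖ ≤ (trace T).re := by
  rw [← Φ.tracePreserving]
  refine norm_le_trace_of_nonneg _ fun y => ?_
  simpa using Φ.completelyPositive 1 (fun _ _ => T) (fun x => by simpa using hT (x 0)) fun _ => y

theorem inner_ketBra_self_nonneg {H : Type*} [NormedAddCommGroup H] [InnerProductSpace ℂ H]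
    (x z : H) : 0 ≤ ⟪z, (ketBra x x : H →L[ℂ] H) z⟫_ℂ := by
  rw [ketBra, rankOne_apply, inner_smul_right, ← inner_conj_symm, RCLike.conj_mul]
  simp

theorem QuantumChannel.norm_ketBra_self_le (Φ : QuantumChannel A B) (x : A) :
    ‖(Φ.toLinearMap (ketBra x x) : B →L[ℂ] B)‖ ≤ ‖x‖ ^ 2 := by
  refine (Φ.norm_le_of_nonneg _ (inner_ketBra_self_nonneg x)).trans_eq ?_
  rw [trace_ketBra, inner_self_eq_norm_sq_to_K]
  norm_cast

/-- Continuity is not part of the definition of a channel. Here the remainder of the series is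
positive, so the norm of its image is at most its trace, which tends to zero. -/
theorem QuantumChannel.hasSum_ketBra_self (Φ : QuantumChannel A B) {κ : Type*} {x : κ → A}
    (hx : Summable (fun n => ‖x n‖ ^ 2)) :
    ∃ T : traceClass A, HasSum (fun n => (ketBra (x n) (x n) : A →L[ℂ] A)) T ∧
      HasSum (fun n => (Φ.toLinearMap (ketBra (x n) (x n)) : B →L[ℂ] B)) (Φ.toLinearMap T) := by
  have hx' : Summable (fun n => ‖x n‖ * ‖x n‖) := by simpa only [sq] using hx
  obtain ⟨T, hT⟩ : Summable (fun n => rankOne ℂ (x n) (x n)) :=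
    Summable.of_norm (by simpa using hx')
  refine ⟨⟨T, isTraceClass_of_hasSum hx' hT⟩, hT, ?_⟩
  set T' : traceClass A := ⟨T, isTraceClass_of_hasSum hx' hT⟩
  have hT' : HasSum (fun n => (ketBra (x n) (x n) : A →L[ℂ] A)) T' := hT
  have htr : HasSum (fun n => ‖x n‖ ^ 2) (trace T').re := by
    have := Complex.hasSum_re (hasSum_trace (T := T') hx' hT)
    simpa only [inner_self_eq_norm_sq_to_K, ← Complex.ofReal_pow, Complex.coe_algebraMap,
      Complex.ofReal_re] using this
  have htrsum : ∀ s : Finset κ, trace (∑ n ∈ s, ketBra (x n) (x n)) = ∑ n ∈ s, ⟪x n, x n⟫_ℂ := by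
    intro s
    refine (hasSum_trace (κ := s) (x := fun n => x n) (y := fun n => x n)
      Summable.of_finite ?_).unique ?_
    · rw [AddSubmonoidClass.coe_finsetSum]
      exact Finset.hasSum s fun n => rankOne ℂ (x n) (x n)
    · exact Finset.hasSum s fun n => ⟪x n, x n⟫_ℂ
  rw [HasSum, tendsto_iff_norm_sub_tendsto_zero]
  have hlim : Filter.Tendsto (fun s : Finset κ => (trace T').re - ∑ n ∈ s, ‖x n‖ ^ 2)
      Filter.atTop (nhds 0) := by
    simpa using htr.const_sub (trace T').re
  refine squeeze_zero (fun _ => norm_nonneg _) (fun s => ?_) hlim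
  have hcoe : ((∑ n ∈ s, ketBra (x n) (x n) : traceClass A) : A →L[ℂ] A) =
      ∑ n ∈ s, (ketBra (x n) (x n) : A →L[ℂ] A) := AddSubmonoidClass.coe_finsetSum _ _
  have h := Φ.norm_le_of_nonneg (T' - ∑ n ∈ s, ketBra (x n) (x n)) fun z => ?_
  · rw [trace_sub, htrsum, map_sub, map_sum, Complex.sub_re, Complex.re_sum] at h
    simp only [inner_self_eq_norm_sq_to_K, ← Complex.ofReal_pow, Complex.coe_algebraMap,
      Complex.ofReal_re] at h
    rw [norm_sub_rev]
    simpa using h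
  · have h1 : HasSum (fun n => ⟪z, (ketBra (x n) (x n) : A →L[ℂ] A) z⟫_ℂ) ⟪z, T z⟫_ℂ :=
      (hT'.mapL (ContinuousLinearMap.apply ℂ A z)).mapL (innerSL ℂ z)
    have h2 := sum_le_hasSum s (fun n _ => inner_ketBra_self_nonneg (x n) z) h1
    rw [AddSubgroupClass.coe_sub, sub_apply, inner_sub_right, sub_nonneg, hcoe]
    simpa [inner_sum, sum_apply] using h2

/-- Balancing the two norms makes the polarized vectors square summable when only `∑ ‖x n‖ ‖y n‖` is
known to converge. -/
theorem exists_rankOne_eq_norm_eq {H : Type*} [NormedAddCommGroup H] [InnerProductSpace ℂ H]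
    (x y : H) : ∃ x' y' : H, ‖x'‖ ^ 2 = ‖x‖ * ‖y‖ ∧ ‖y'‖ ^ 2 = ‖x‖ * ‖y‖ ∧
      ketBra x y = ketBra x' y' := by
  by_cases h : x = 0 ∨ y = 0
  · refine ⟨0, 0, ?_, ?_, Subtype.ext ?_⟩
    · rcases h with rfl | rfl <;> simp
    · rcases h with rfl | rfl <;> simp
    · rcases h with rfl | rfl <;> simp [ketBra]
  · rw [not_or] at h
    have hx : 0 < ‖x‖ := norm_pos_iff.mpr h.1
    have hy : 0 < ‖y‖ := norm_pos_iff.mpr h.2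
    set c : ℝ := √(‖y‖ / ‖x‖) with hc
    have hcpos : 0 < c := Real.sqrt_pos.mpr (by positivity)
    have hc2 : c ^ 2 = ‖y‖ / ‖x‖ := Real.sq_sqrt (by positivity)
    refine ⟨(c : ℂ) • x, ((c⁻¹ : ℝ) : ℂ) • y, ?_, ?_, Subtype.ext ?_⟩
    · rw [norm_smul, mul_pow, Complex.norm_real, Real.norm_of_nonneg hcpos.le, hc2]
      field_simp
    · rw [norm_smul, mul_pow, Complex.norm_real, Real.norm_of_nonneg (by positivity), inv_pow, hc2]
      field_simp
    · have hcc : (c : ℂ) ≠ 0 := by exact_mod_cast hcpos.ne'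
      simp only [ketBra, map_smulₛₗ, smul_apply, smul_smul, Complex.conj_ofReal,
        Complex.ofReal_inv, RingHom.id_apply, map_inv₀]
      rw [inv_mul_cancel₀ hcc, one_smul]

theorem ketBra_polarization {H : Type*} [NormedAddCommGroup H] [InnerProductSpace ℂ H] (x y : H) :
    ketBra x y = (1 / 4 : ℂ) • ((ketBra (x + y) (x + y) - ketBra (x - y) (x - y)) +
      Complex.I • (ketBra (x + Complex.I • y) (x + Complex.I • y) -
        ketBra (x - Complex.I • y) (x - Complex.I • y))) := by
  refine Subtype.ext (ContinuousLinearMap.ext fun z => ?_)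
  simp only [ketBra, SetLike.val_smul, AddMemClass.coe_add, AddSubgroupClass.coe_sub, add_apply,
    sub_apply, smul_apply, rankOne_apply, inner_add_left, inner_sub_left, inner_smul_left]
  simp only [Complex.conj_I]
  match_scalars <;> (ring_nf; simp; try ring)

theorem norm_add_sq_le_of_sq_eq {H : Type*} [NormedAddCommGroup H] {x y : H} {r : ℝ}
    (hx : ‖x‖ ^ 2 = r) (hy : ‖y‖ ^ 2 = r) : ‖x + y‖ ^ 2 ≤ 4 * r := by
  have h1 := norm_add_le x y
  have h2 : ‖x‖ = ‖y‖ := by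
    rw [← sq_eq_sq₀ (norm_nonneg _) (norm_nonneg _), hx, hy]
  nlinarith [norm_nonneg (x + y), norm_nonneg y]

theorem QuantumChannel.hasSum_ketBra (Φ : QuantumChannel A B) {κ : Type*} {x y : κ → A}
    (hs : Summable (fun n => ‖x n‖ * ‖y n‖)) {T : traceClass A}
    (hT : HasSum (fun n => (ketBra (x n) (y n) : A →L[ℂ] A)) T) :
    HasSum (fun n => (Φ.toLinearMap (ketBra (x n) (y n)) : B →L[ℂ] B)) (Φ.toLinearMap T) := by
  choose u v hu hv huv using fun n => exists_rankOne_eq_norm_eq (x n) (y n)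
  have hI : ∀ n, ‖Complex.I • v n‖ ^ 2 = ‖x n‖ * ‖y n‖ := fun n => by
    rw [norm_smul, Complex.norm_I, one_mul, hv]
  have hsum : ∀ w : κ → A, (∀ n, ‖w n‖ ^ 2 = ‖x n‖ * ‖y n‖) →
      Summable (fun n => ‖u n + w n‖ ^ 2) := fun w hw =>
    (hs.mul_left 4).of_nonneg_of_le (fun _ => by positivity)
      fun n => norm_add_sq_le_of_sq_eq (hu n) (hw n)
  obtain ⟨T1, h1, h1'⟩ := Φ.hasSum_ketBra_self (hsum v hv)
  obtain ⟨T2, h2, h2'⟩ := Φ.hasSum_ketBra_self (hsum (fun n => -v n) (by simpa using hv))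
  obtain ⟨T3, h3, h3'⟩ := Φ.hasSum_ketBra_self (hsum (fun n => Complex.I • v n) hI)
  obtain ⟨T4, h4, h4'⟩ := Φ.hasSum_ketBra_self (hsum (fun n => -(Complex.I • v n))
    (by simpa using hI))
  simp only [← sub_eq_add_neg] at h2 h2' h4 h4'
  have key : T = (1 / 4 : ℂ) • ((T1 - T2) + Complex.I • (T3 - T4)) := by
    refine Subtype.ext (hT.unique ?_)
    simp only [huv, ketBra_polarization (u _)]
    exact ((h1.sub h2).add ((h3.sub h4).const_smul Complex.I)).const_smul (1 / 4 : ℂ)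
  rw [key]
  simp only [huv, ketBra_polarization (u _), map_smul, map_add, map_sub]
  exact ((h1'.sub h2').add ((h3'.sub h4').const_smul Complex.I)).const_smul (1 / 4 : ℂ)

theorem QuantumChannel.ext_ketBra {Φ Ψ : QuantumChannel A B}
    (h : ∀ x y, Φ.toLinearMap (ketBra x y) = Ψ.toLinearMap (ketBra x y)) : Φ = Ψ := by
  have hlin : Φ.toLinearMap = Ψ.toLinearMap := by
    refine LinearMap.ext fun T => Subtype.ext ?_
    obtain ⟨x, y, hs, hT⟩ := T.2
    refine (Φ.hasSum_ketBra hs hT).unique ?_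
    simp only [h]
    exact Ψ.hasSum_ketBra hs hT
  cases Φ
  cases Ψ
  cases hlin
  rfl

theorem QuantumChannel.norm_ketBra_le (Φ : QuantumChannel A B) (x y : A) :
    ‖(Φ.toLinearMap (ketBra x y) : B →L[ℂ] B)‖ ≤ 4 * ‖x‖ * ‖y‖ := by
  obtain ⟨u, v, hu, hv, huv⟩ := exists_rankOne_eq_norm_eq x y
  have hI : ‖Complex.I • v‖ ^ 2 = ‖x‖ * ‖y‖ := by
    rw [norm_smul, Complex.norm_I, one_mul, hv]
  have hle : ∀ w : A, ‖w‖ ^ 2 = ‖x‖ * ‖y‖ →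
      ‖(Φ.toLinearMap (ketBra (u + w) (u + w)) : B →L[ℂ] B)‖ ≤ 4 * (‖x‖ * ‖y‖) := fun w hw =>
    (Φ.norm_ketBra_self_le _).trans (norm_add_sq_le_of_sq_eq hu hw)
  have h1 := hle v hv
  have h2 := hle (-v) (by simpa using hv)
  have h3 := hle (Complex.I • v) hI
  have h4 := hle (-(Complex.I • v)) (by simpa using hI)
  simp only [← sub_eq_add_neg] at h2 h4
  rw [huv, ketBra_polarization u]
  simp only [map_smul, map_add, map_sub, SetLike.val_smul, AddMemClass.coe_add,
    AddSubgroupClass.coe_sub]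
  refine (norm_smul_le _ _).trans ?_
  have hq : ‖(1 / 4 : ℂ)‖ = 1 / 4 := by norm_num
  rw [hq]
  have h5 := norm_add_le
    ((Φ.toLinearMap (ketBra (u + v) (u + v)) : B →L[ℂ] B) -
      (Φ.toLinearMap (ketBra (u - v) (u - v)) : B →L[ℂ] B))
    (Complex.I • ((Φ.toLinearMap (ketBra (u + Complex.I • v) (u + Complex.I • v)) : B →L[ℂ] B) -
      (Φ.toLinearMap (ketBra (u - Complex.I • v) (u - Complex.I • v)) : B →L[ℂ] B)))
  rw [norm_smul, Complex.norm_I, one_mul] at h5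
  linarith [norm_sub_le (Φ.toLinearMap (ketBra (u + v) (u + v)) : B →L[ℂ] B)
      (Φ.toLinearMap (ketBra (u - v) (u - v)) : B →L[ℂ] B),
    norm_sub_le (Φ.toLinearMap (ketBra (u + Complex.I • v) (u + Complex.I • v)) : B →L[ℂ] B)
      (Φ.toLinearMap (ketBra (u - Complex.I • v) (u - Complex.I • v)) : B →L[ℂ] B)]

/-- The linear functional `x ↦ ⟪z, Φ (|x⟩⟨y|) z'⟫`. -/
def QuantumChannel.leftFunctional (Φ : QuantumChannel A B) (y : A) (z z' : B) : A →L[ℂ] ℂ :=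
  LinearMap.mkContinuous
    { toFun := fun x => ⟪z, (Φ.toLinearMap (ketBra x y) : B →L[ℂ] B) z'⟫_ℂ
      map_add' := fun x x' => by
        have : ketBra (x + x') y = ketBra x y + ketBra x' y :=
          Subtype.ext (by simp [ketBra])
        simp [this]
      map_smul' := fun c x => by
        have : ketBra (c • x) y = c • ketBra x y := Subtype.ext (by simp [ketBra])
        simp [this] } (‖z‖ * (4 * ‖y‖ * ‖z'‖)) fun x => by
    refine (norm_inner_le_norm _ _).trans ?_
    have h := (le_opNorm (Φ.toLinearMap (ketBra x y) : B →L[ℂ] B) z').trans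
      (mul_le_mul_of_nonneg_right (Φ.norm_ketBra_le x y) (norm_nonneg z'))
    calc _ ≤ ‖z‖ * (4 * ‖x‖ * ‖y‖ * ‖z'‖) := by gcongr
      _ = _ := by ring

/-- The conjugate of the antilinear functional `y ↦ ⟪z, Φ (|x⟩⟨y|) z'⟫`. -/
def QuantumChannel.rightFunctional (Φ : QuantumChannel A B) (x : A) (z z' : B) : A →L[ℂ] ℂ :=
  LinearMap.mkContinuous
    { toFun := fun y => ⟪(Φ.toLinearMap (ketBra x y) : B →L[ℂ] B) z', z⟫_ℂ
      map_add' := fun y y' => by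
        have : ketBra x (y + y') = ketBra x y + ketBra x y' :=
          Subtype.ext (by simp [ketBra])
        simp [this]
      map_smul' := fun c y => by
        have : ketBra x (c • y) = (starRingEnd ℂ c) • ketBra x y :=
          Subtype.ext (by simp [ketBra])
        simp [this, mul_comm] } (‖z‖ * (4 * ‖x‖ * ‖z'‖)) fun y => by
    refine (norm_inner_le_norm _ _).trans ?_
    have h := (le_opNorm (Φ.toLinearMap (ketBra x y) : B →L[ℂ] B) z').trans
      (mul_le_mul_of_nonneg_right (Φ.norm_ketBra_le x y) (norm_nonneg z'))
    calc _ ≤ 4 * ‖x‖ * ‖y‖ * ‖z'‖ * ‖z‖ := by gcongr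
      _ = _ := by ring

/-- Matrix elements of `Φ (|x⟩⟨y|)` are continuous and (anti)linear in each of `x` and `y`, so
agreement extends from `S` one variable at a time. -/
theorem QuantumChannel.ext_of_dense {Φ Ψ : QuantumChannel A B} {S : Set A}
    (hS : Dense (Submodule.span ℂ S : Set A))
    (h : ∀ x ∈ S, ∀ y ∈ S, Φ.toLinearMap (ketBra x y) = Ψ.toLinearMap (ketBra x y)) : Φ = Ψ := by
  have h1 : ∀ x, ∀ y ∈ S, Φ.toLinearMap (ketBra x y) = Ψ.toLinearMap (ketBra x y) := by
    refine fun x y hy => traceClass_ext fun z z' => ?_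
    have : Φ.leftFunctional y z z' = Ψ.leftFunctional y z z' :=
      ContinuousLinearMap.ext_on hS fun x hx =>
        congrArg (fun R : traceClass B => ⟪z, (R : B →L[ℂ] B) z'⟫_ℂ) (h x hx y hy)
    exact congrArg (fun f => f x) this
  refine QuantumChannel.ext_ketBra fun x y => traceClass_ext fun z z' => ?_
  have : Φ.rightFunctional x z z' = Ψ.rightFunctional x z z' :=
    ContinuousLinearMap.ext_on hS fun y hy =>
      congrArg (fun R : traceClass B => ⟪(R : B →L[ℂ] B) z', z⟫_ℂ) (h1 x y hy)
  have h2 : ⟪(Φ.toLinearMap (ketBra x y) : B →L[ℂ] B) z', z⟫_ℂ =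
    ⟪(Ψ.toLinearMap (ketBra x y) : B →L[ℂ] B) z', z⟫_ℂ := congrArg (fun f => f y) this
  rw [← inner_conj_symm, h2, inner_conj_symm]

end Channel

/-! ### Kraus representation -/

section

variable {A : Type u} {B : Type v} [NormedAddCommGroup A] [InnerProductSpace ℂ A] [CompleteSpace A]
  [NormedAddCommGroup B] [InnerProductSpace ℂ B] [CompleteSpace B]

/-- The operator valued kernel `(a, a') ↦ Φ (|a⟩⟨a'|)`. -/
def QuantumChannel.kernel (Φ : QuantumChannel A B) : Matrix A A (B →L[ℂ] B) :=
  Matrix.of fun a a' => Φ.toLinearMap (ketBra a a')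

theorem QuantumChannel.kernel_sum_nonneg (Φ : QuantumChannel A B) {n : ℕ} (a : Fin n → A)
    (y : Fin n → B) : 0 ≤ ∑ i, ∑ j, ⟪y i, Φ.kernel (a i) (a j) (y j)⟫_ℂ := by
  refine Φ.completelyPositive n (fun i j => ketBra (a i) (a j)) (fun x => ?_) y
  have : ∑ i, ∑ j, ⟪x i, (ketBra (a i) (a j) : A →L[ℂ] A) (x j)⟫_ℂ =
      (∑ i, ⟪x i, a i⟫_ℂ) * (starRingEnd ℂ) (∑ i, ⟪x i, a i⟫_ℂ) := by
    rw [map_sum, Finset.sum_mul_sum]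
    refine Finset.sum_congr rfl fun i _ => Finset.sum_congr rfl fun j _ => ?_
    rw [ketBra, rankOne_apply, inner_smul_right, inner_conj_symm, mul_comm]
  rw [this, RCLike.mul_conj]
  simp

/-- Nonnegative sums are real. For the pair `a', a` this makes the two cross terms together real;
taking `b` and then `Complex.I • b` yields the imaginary and the real part of the identity. -/
theorem QuantumChannel.inner_kernel_conj (Φ : QuantumChannel A B) (a a' : A) (b b' : B) :
    ⟪Φ.kernel a a' b', b⟫_ℂ = ⟪b', Φ.kernel a' a b⟫_ℂ := by
  have hdiag : ∀ a b, (⟪b, Φ.kernel a a b⟫_ℂ).im = 0 := fun a b => by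
    have := Φ.kernel_sum_nonneg (n := 1) (fun _ => a) fun _ => b
    simpa using (Complex.nonneg_iff.mp this).2.symm
  have hsum : ∀ y, (⟪b', Φ.kernel a' a y⟫_ℂ + ⟪y, Φ.kernel a a' b'⟫_ℂ).im = 0 := fun y => by
    have := Φ.kernel_sum_nonneg ![a', a] ![b', y]
    have h2 := (Complex.nonneg_iff.mp this).2
    simp only [Fin.sum_univ_two, Matrix.cons_val_zero, Matrix.cons_val_one, Complex.add_im,
      hdiag] at h2
    rw [Complex.add_im]
    linarith
  have h1 := hsum b
  have h2 := hsum (Complex.I • b)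
  rw [map_smul, inner_smul_right, inner_smul_left] at h2
  rw [← inner_conj_symm]
  simp at h1 h2
  refine Complex.ext ?_ ?_
  · rw [Complex.conj_re]; linarith
  · rw [Complex.conj_im]; linarith

theorem QuantumChannel.kernel_posSemidef (Φ : QuantumChannel A B) : Φ.kernel.PosSemidef := by
  have htfae : Φ.kernel.PosSemidef ↔ Φ.kernel.IsHermitian ∧ ∀ v : A →₀ B,
      0 ≤ RCLike.re (v.sum fun x w => v.sum fun x' w' => ⟪Φ.kernel x' x w, w'⟫_ℂ) :=
    RKHS.posSemidef_tfae.out 0 2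
  refine htfae.mpr ⟨?_, fun v => ?_⟩
  · refine Matrix.IsHermitian.ext fun a a' => ?_
    rw [star_eq_adjoint]
    refine ContinuousLinearMap.ext fun b => ext_inner_left ℂ fun b' => ?_
    rw [adjoint_inner_right, Φ.inner_kernel_conj]
  · have e := v.support.equivFin.symm
    have h := Φ.kernel_sum_nonneg (fun i => (e i : A)) (fun i => v (e i))
    have h2 : ∑ i, ∑ j, ⟪v (e i), Φ.kernel (e i) (e j) (v (e j))⟫_ℂ =
        v.sum fun x w => v.sum fun x' w' => ⟪Φ.kernel x' x w, w'⟫_ℂ := by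
      simp only [Φ.inner_kernel_conj, Finsupp.sum]
      rw [← Finset.sum_coe_sort v.support, ← Equiv.sum_comp e]
      refine Finset.sum_congr rfl fun i _ => ?_
      rw [← Finset.sum_coe_sort v.support, ← Equiv.sum_comp e]
    rw [h2] at h
    exact (Complex.nonneg_iff.mp h).1

/-- Complete positivity makes `(a, a') ↦ Φ (|a⟩⟨a'|)` the reproducing kernel of a Hilbert space `E`
of functions `A → B`. These functions are linear and bounded, and the members of an orthonormal
basis of `E` are the Kraus operators: Parseval for the kernel functions is the Kraus formula. -/
theorem QuantumChannel.exists_kraus (Φ : QuantumChannel A B) :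
    ∃ (ι : Type (max u v)) (V : ι → A →L[ℂ] B) (h : IsKraus V), Φ = h.channel := by
  have : Fact Φ.kernel.PosSemidef := ⟨Φ.kernel_posSemidef⟩
  let E := RKHS.OfKernel Φ.kernel
  have hK : ∀ a a' b b', ⟪RKHS.kerFun E a b, RKHS.kerFun E a' b'⟫_ℂ =
      ⟪b, (Φ.toLinearMap (ketBra a a') : B →L[ℂ] B) b'⟫_ℂ := fun a a' b b' => by
    rw [← adjoint_inner_right]
    have h := RKHS.kernel_apply E a a'
    rw [RKHS.OfKernel.kernel_ofKernel] at h
    have h2 := congrArg (fun R : B →L[ℂ] B => ⟪b, R b'⟫_ℂ) h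
    exact h2.symm
  obtain ⟨w, f, -⟩ := exists_hilbertBasis ℂ E
  have hext : ∀ g g' : E, (∀ a b, ⟪RKHS.kerFun E a b, g⟫_ℂ = ⟪RKHS.kerFun E a b, g'⟫_ℂ) →
      g = g' := fun g g' h => RKHS.ext fun a => ext_inner_left ℂ fun b => by
    simpa [RKHS.kerFun_inner] using h a b
  -- The kernel functions depend antilinearly on `a`; by the reproducing property the elements of
  -- `E` are then linear in `a`.
  have hadd : ∀ a a' b, RKHS.kerFun E (a + a') b = RKHS.kerFun E a b + RKHS.kerFun E a' b :=
    fun a a' b => hext _ _ fun x y => by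
      have : ketBra x (a + a') = ketBra x a + ketBra x a' := Subtype.ext (by simp [ketBra])
      rw [inner_add_right, hK, hK, hK, this]
      simp
  have hsmul : ∀ (c : ℂ) a b, RKHS.kerFun E (c • a) b = (starRingEnd ℂ c) • RKHS.kerFun E a b :=
    fun c a b => hext _ _ fun x y => by
      have : ketBra x (c • a) = (starRingEnd ℂ c) • ketBra x a :=
        Subtype.ext (by simp [ketBra])
      rw [inner_smul_right, hK, hK, this]
      simp
  let V : w → A →L[ℂ] B := fun k => LinearMap.mkContinuous
    { toFun := fun a => f k a
      map_add' := fun a a' => ext_inner_left ℂ fun b => by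
        rw [inner_add_right, ← RKHS.kerFun_inner, ← RKHS.kerFun_inner, ← RKHS.kerFun_inner, hadd,
          inner_add_left]
      map_smul' := fun c a => ext_inner_left ℂ fun b => by
        rw [RingHom.id_apply, inner_smul_right, ← RKHS.kerFun_inner, ← RKHS.kerFun_inner, hsmul,
          inner_smul_left, RingHomCompTriple.comp_apply, RingHom.id_apply] } 1 fun a => by
    refine (RKHS.norm_apply_le (f k) a).trans ?_
    rw [f.orthonormal.1 k]
    gcongr
    rw [RKHS.OfKernel.kernel_ofKernel]
    exact (Real.sqrt_le_sqrt (Φ.norm_ketBra_self_le a)).trans_eq (Real.sqrt_sq (norm_nonneg a))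
  have hV : ∀ k a b, ⟪b, V k a⟫_ℂ = ⟪RKHS.kerFun E a b, f k⟫_ℂ := fun k a b =>
    (RKHS.kerFun_inner a b (f k)).symm
  have hsum : ∀ a a' b b', HasSum (fun k => ⟪b, V k a⟫_ℂ * ⟪V k a', b'⟫_ℂ)
      ⟪b, (Φ.toLinearMap (ketBra a a') : B →L[ℂ] B) b'⟫_ℂ := fun a a' b b' => by
    rw [← hK]
    refine (f.hasSum_inner_mul_inner _ _).congr_fun fun k => ?_
    rw [hV, ← inner_conj_symm (V k a'), hV, inner_conj_symm]
  have hkraus : IsKraus V := fun a => by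
    obtain ⟨_, b, -⟩ := exists_hilbertBasis ℂ B
    have hrow : ∀ i, HasSum (fun k => ‖⟪b i, V k a⟫_ℂ‖ ^ 2)
        (⟪b i, (Φ.toLinearMap (ketBra a a) : B →L[ℂ] B) (b i)⟫_ℂ).re := fun i => by
      refine (Complex.hasSum_re (hsum a a (b i) (b i))).congr_fun fun k => ?_
      rw [← inner_conj_symm (V k a), RCLike.mul_conj]
      norm_cast
    have htr := Complex.hasSum_re (hasSum_inner_self_trace b (Φ.toLinearMap (ketBra a a)))
    rw [Φ.tracePreserving, trace_ketBra, inner_self_eq_norm_sq_to_K] at htr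
    -- Summed over `k` first, the double series is the trace of `Φ (|a⟩⟨a|)`, that is `‖a‖ ^ 2`;
    -- summed over the basis of `B` first, it is `∑ₖ ‖V k a‖ ^ 2`.
    have hs : Summable (fun p : _ × w => ‖⟪b p.1, V p.2 a⟫_ℂ‖ ^ 2) := by
      refine (summable_prod_of_nonneg fun p => by positivity).mpr ⟨fun i => (hrow i).summable, ?_⟩
      exact htr.summable.congr fun i => (hrow i).tsum_eq.symm
    have h1 := (hs.hasSum.prod_fiberwise hrow).unique htr
    have h2 := ((Equiv.prodComm w _).hasSum_iff.mpr hs.hasSum).prod_fiberwise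
      (g := fun k => ‖V k a‖ ^ 2) fun k => hasSum_norm_inner_sq b (V k a)
    rw [h1] at h2
    refine h2.trans_eq ?_
    norm_cast
  refine ⟨w, V, hkraus, QuantumChannel.ext_ketBra fun x y => traceClass_ext fun z z' => ?_⟩
  exact (hsum x y z z').unique (hkraus.hasSum_channel_ketBra x y z z')

end

/-! ### Reversibility in terms of Kraus operators -/

/-- A total orthogonal family of closed subspaces has an adapted Hilbert basis. -/
theorem exists_hilbertBasis_mem {H : Type u} {κ : Type v} [NormedAddCommGroup H] [InnerProductSpace ℂ H]
    [CompleteSpace H] (F : κ → Submodule ℂ H) (hclosed : ∀ i, IsClosed (F i : Set H))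
    (hortho : ∀ i j, i ≠ j → ∀ x ∈ F i, ∀ y ∈ F j, ⟪x, y⟫_ℂ = 0)
    (htotal : ∀ x, (∀ i, ∀ y ∈ F i, ⟪y, x⟫_ℂ = 0) → x = 0) :
    ∃ (ι : Type (max u v)) (b : HilbertBasis ι ℂ H) (τ : ι → κ), ∀ s, b s ∈ F (τ s) := by
  have : ∀ i, CompleteSpace (F i) := fun i => (hclosed i).completeSpace_coe
  choose w b hb using fun i => exists_hilbertBasis ℂ (F i)
  have hV : OrthogonalFamily ℂ (fun i => F i) fun i => (F i).subtypeₗᵢ :=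
    fun i j hij x y => hortho i j hij x x.2 y y.2
  have horth := hV.orthonormal_sigma_orthonormal fun i => (b i).orthonormal
  refine ⟨Σ i, w i, HilbertBasis.mkOfOrthogonalEqBot horth ?_, Sigma.fst, fun s => ?_⟩
  · rw [eq_bot_iff]
    intro x hx
    refine htotal x fun i y hy => ?_
    rw [Submodule.mem_orthogonal] at hx
    have h0 : (innerSL ℂ x) ∘L (F i).subtypeL = 0 := by
      refine ContinuousLinearMap.ext_on (s := Set.range (b i)) ?_ ?_
      · rw [dense_iff_closure_eq, ← Submodule.topologicalClosure_coe, (b i).dense_span]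
        rfl
      · rintro _ ⟨s, rfl⟩
        have := hx _ (Submodule.subset_span ⟨⟨i, s⟩, rfl⟩)
        rw [← inner_conj_symm, map_eq_zero] at this
        exact this
    rw [← inner_conj_symm, map_eq_zero]
    exact congrArg (fun f => f ⟨y, hy⟩) h0
  · rw [HilbertBasis.coe_mkOfOrthogonalEqBot]
    exact (b s.1 s.2).2

/-- `φ` is a joint eigenvector of all the operators `(V k)† (V l)`. -/
def IsJointEigenvector {A B ι : Type*} [NormedAddCommGroup A] [InnerProductSpace ℂ A]
    [NormedAddCommGroup B] [InnerProductSpace ℂ B] (V : ι → A →L[ℂ] B) (φ : A) : Prop :=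
  ∃ c : ι → ι → ℂ, ∀ k l a, ⟪V l φ, V k a⟫_ℂ = c k l * ⟪φ, a⟫_ℂ

/-- The joint eigenspace of the operators `(V k)† (V l)`. -/
def jointEigenspace {A B ι : Type*} [NormedAddCommGroup A] [InnerProductSpace ℂ A]
    [NormedAddCommGroup B] [InnerProductSpace ℂ B] (V : ι → A →L[ℂ] B) (c : ι → ι → ℂ) :
    Submodule ℂ A where
  carrier := {φ | ∀ k l a, ⟪V l φ, V k a⟫_ℂ = c k l * ⟪φ, a⟫_ℂ}
  zero_mem' := by simp
  add_mem' := fun hx hy k l a => by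
    rw [map_add, inner_add_left, inner_add_left, hx, hy, mul_add]
  smul_mem' := fun r x hx k l a => by
    rw [map_smul, inner_smul_left, inner_smul_left, hx, mul_left_comm]

section Eigen

variable {A B ι : Type*} [NormedAddCommGroup A] [InnerProductSpace ℂ A]
  [NormedAddCommGroup B] [InnerProductSpace ℂ B] {V : ι → A →L[ℂ] B}

theorem isClosed_jointEigenspace (c : ι → ι → ℂ) : IsClosed (jointEigenspace V c : Set A) := by
  have : (jointEigenspace V c : Set A) =
      ⋂ k, ⋂ l, ⋂ a, {φ | ⟪V l φ, V k a⟫_ℂ = c k l * ⟪φ, a⟫_ℂ} := by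
    ext φ
    simp [jointEigenspace]
  rw [this]
  exact isClosed_iInter fun k => isClosed_iInter fun l => isClosed_iInter fun a =>
    isClosed_eq (by fun_prop) (by fun_prop)

/-- The adjoint of `(V k)† (V l)` is `(V l)† (V k)`, again in the family, so the usual argument for
normal operators applies: `⟪x, y⟫ ≠ 0` would identify the eigenvalues. -/
theorem inner_eq_zero_of_mem_jointEigenspace {c c' : ι → ι → ℂ} (hc : c ≠ c') {x y : A}
    (hx : x ∈ jointEigenspace V c) (hy : y ∈ jointEigenspace V c') : ⟪x, y⟫_ℂ = 0 := by
  by_contra hxy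
  refine hc (funext fun k => funext fun l => ?_)
  have hy0 : ⟪y, y⟫_ℂ ≠ 0 := fun h => hxy (by rw [inner_self_eq_zero.mp h, inner_zero_right])
  have h1 := hx k l y
  have h2 := congrArg (starRingEnd ℂ) (hy l k x)
  have h3 := congrArg (starRingEnd ℂ) (hy l k y)
  rw [map_mul, inner_conj_symm, inner_conj_symm] at h2 h3
  rw [hy k l y] at h3
  rw [mul_right_cancel₀ hxy (h1.symm.trans h2), mul_right_cancel₀ hy0 h3]

theorem exists_hilbertBasis_jointEigenvector {A : Type u} {B : Type v} {ι : Type w}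
    [NormedAddCommGroup A] [InnerProductSpace ℂ A] [CompleteSpace A]
    [NormedAddCommGroup B] [InnerProductSpace ℂ B] {V : ι → A →L[ℂ] B}
    (hV : Dense (Submodule.span ℂ {φ | IsJointEigenvector V φ} : Set A)) :
    ∃ (σ : Type (max u w)) (e : HilbertBasis σ ℂ A), ∀ i, IsJointEigenvector V (e i) := by
  have htotal : ∀ x, (∀ c, ∀ y ∈ jointEigenspace V c, ⟪y, x⟫_ℂ = 0) → x = 0 := fun x hx => by
    refine inner_self_eq_zero (𝕜 := ℂ).mp ?_
    have : innerSL ℂ x = 0 := ContinuousLinearMap.ext_on hV fun φ ⟨c, hφ⟩ => by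
      rw [innerSL_apply_apply, zero_apply, ← inner_conj_symm, hx c φ hφ, map_zero]
    exact congrArg (fun f => f x) this
  obtain ⟨σ, e, τ, he⟩ := exists_hilbertBasis_mem (jointEigenspace V) isClosed_jointEigenspace
    (fun c c' hc x hx y hy => inner_eq_zero_of_mem_jointEigenspace hc hx hy) htotal
  exact ⟨σ, e, fun i => ⟨τ i, he i⟩⟩

end Eigen

/-! ### Pure states fixed by a channel. -/

section Fixed

variable {A ι : Type*} [NormedAddCommGroup A] [InnerProductSpace ℂ A] {R : ι → A →L[ℂ] A}

/-- The terms `|R p φ⟩⟨R p φ|` are positive with sum `|φ⟩⟨φ|`, so none has a component orthogonal to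
`φ`; evaluating the sum at that component `b` shows `b = 0`. -/
theorem IsKraus.eq_smul_of_channel_fixed [CompleteSpace A] (h : IsKraus R) {φ : A} (hφ : ‖φ‖ = 1)
    (hfix : h.channel.toLinearMap (ketBra φ φ) = ketBra φ φ) (p : ι) :
    R p φ = ⟪φ, R p φ⟫_ℂ • φ := by
  have hφφ : ⟪φ, φ⟫_ℂ = 1 := by rw [inner_self_eq_norm_sq_to_K, hφ]; simp
  set b := R p φ - ⟪φ, R p φ⟫_ℂ • φ with hb
  have hφb : ⟪φ, b⟫_ℂ = 0 := by rw [hb, inner_sub_right, inner_smul_right, hφφ, mul_one, sub_self]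
  have hbφ : ⟪b, φ⟫_ℂ = 0 := inner_eq_zero_symm.mp hφb
  have hs := h.hasSum_channel_ketBra φ φ b b
  rw [hfix, ketBra, rankOne_apply, inner_smul_right, hφb, zero_mul] at hs
  have hs' := Complex.hasSum_re hs
  have hterm : ∀ p, (⟪b, R p φ⟫_ℂ * ⟪R p φ, b⟫_ℂ).re = ‖⟪b, R p φ⟫_ℂ‖ ^ 2 := fun p => by
    rw [← inner_conj_symm (R p φ), RCLike.mul_conj]
    norm_cast
  simp only [hterm, Complex.zero_re] at hs'
  have h0 := congrFun ((hasSum_zero_iff_of_nonneg fun p => by positivity).mp hs') p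
  have hbR : ⟪b, R p φ⟫_ℂ = 0 := by simpa using h0
  have : ⟪b, b⟫_ℂ = 0 := by
    conv_lhs => rw [hb]
    rw [← hb, inner_sub_right, inner_smul_right, hbR, hbφ, mul_zero, sub_zero]
  exact sub_eq_zero.mp (inner_self_eq_zero.mp this)

theorem IsKraus.hasSum_conj_mul_of_eigen (h : IsKraus R) {x y : A} {r s : ι → ℂ}
    (hx : ∀ p, R p x = r p • x) (hy : ∀ p, R p y = s p • y) (hxy : ⟪x, y⟫_ℂ ≠ 0) :
    HasSum (fun p => (starRingEnd ℂ) (r p) * s p) 1 := by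
  have := (h.hasSum_inner x y).div_const ⟪x, y⟫_ℂ
  rw [div_self hxy] at this
  refine this.congr_fun fun p => ?_
  rw [hx, hy, inner_smul_left, inner_smul_right]
  field_simp

/-- By `hasSum_conj_mul_of_eigen`, `r` and `s` are unit vectors of `ℓ²` with inner product `1`, so
`‖r - s‖² = 1 - 1 - 1 + 1 = 0`. -/
theorem IsKraus.eigenvalue_eq (h : IsKraus R) {x y : A} {r s : ι → ℂ}
    (hx : ∀ p, R p x = r p • x) (hy : ∀ p, R p y = s p • y) (hxy : ⟪x, y⟫_ℂ ≠ 0) : r = s := by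
  have hx0 : ⟪x, x⟫_ℂ ≠ 0 := fun h => hxy (by rw [inner_self_eq_zero.mp h, inner_zero_left])
  have hy0 : ⟪y, y⟫_ℂ ≠ 0 := fun h => hxy (by rw [inner_self_eq_zero.mp h, inner_zero_right])
  have hyx : ⟪y, x⟫_ℂ ≠ 0 := fun h => hxy (inner_eq_zero_symm.mp h)
  have hs := Complex.hasSum_re ((((h.hasSum_conj_mul_of_eigen hx hx hx0).sub
    (h.hasSum_conj_mul_of_eigen hx hy hxy)).sub (h.hasSum_conj_mul_of_eigen hy hx hyx)).add
    (h.hasSum_conj_mul_of_eigen hy hy hy0))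
  have hterm : ∀ p, ((starRingEnd ℂ) (r p) * r p - (starRingEnd ℂ) (r p) * s p -
      (starRingEnd ℂ) (s p) * r p + (starRingEnd ℂ) (s p) * s p).re = ‖r p - s p‖ ^ 2 := by
    intro p
    rw [Complex.sq_norm, Complex.normSq_apply]
    simp
    ring
  simp only [hterm] at hs
  norm_num at hs
  have h0 := (hasSum_zero_iff_of_nonneg fun p => by positivity).mp hs
  refine funext fun p => sub_eq_zero.mp ?_
  simpa using congrFun h0 p

theorem IsKraus.channel_ketBra_of_eigen [CompleteSpace A] (h : IsKraus R) {x y : A} {r : ι → ℂ}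
    (hx : ∀ p, R p x = r p • x) (hy : ∀ p, R p y = r p • y) :
    h.channel.toLinearMap (ketBra x y) = ketBra x y := by
  by_cases hx0 : x = 0
  · have : ketBra x y = 0 := Subtype.ext (by simp [ketBra, hx0])
    rw [this, map_zero]
  · refine traceClass_ext fun z z' => (h.hasSum_channel_ketBra x y z z').unique ?_
    have h1 := (h.hasSum_conj_mul_of_eigen hx hx (inner_self_ne_zero.mpr hx0)).mul_right
      (⟪z, x⟫_ℂ * ⟪y, z'⟫_ℂ)
    rw [one_mul] at h1
    rw [ketBra, rankOne_apply, inner_smul_right, mul_comm ⟪y, z'⟫_ℂ]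
    refine h1.congr_fun fun p => ?_
    rw [hx, hy, inner_smul_left, inner_smul_right]
    ring

end Fixed

/-! ### Composition of channels. -/

section Comp

variable {A B C ι κ : Type*} [NormedAddCommGroup A] [InnerProductSpace ℂ A]
  [NormedAddCommGroup B] [InnerProductSpace ℂ B] [NormedAddCommGroup C] [InnerProductSpace ℂ C]
  {V : ι → A →L[ℂ] B} {W : κ → B →L[ℂ] C}

theorem IsKraus.comp (hW : IsKraus W) (hV : IsKraus V) :
    IsKraus (fun p : ι × κ => W p.2 ∘L V p.1) := fun a => by
  have hrow : ∀ k, HasSum (fun m => ‖W m (V k a)‖ ^ 2) (‖V k a‖ ^ 2) := fun k => hW (V k a)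
  have hs : Summable (fun p : ι × κ => ‖W p.2 (V p.1 a)‖ ^ 2) := by
    refine (summable_prod_of_nonneg fun p => by positivity).mpr ⟨fun k => (hrow k).summable, ?_⟩
    exact (hV a).summable.congr fun k => (hrow k).tsum_eq.symm
  rw [(hV a).unique (hs.hasSum.prod_fiberwise hrow)]
  exact hs.hasSum

variable [CompleteSpace A] [CompleteSpace B] [CompleteSpace C]

theorem IsKraus.comp_channel_ketBra (hW : IsKraus W) (hV : IsKraus V) (x y : A) :
    (hW.comp hV).channel.toLinearMap (ketBra x y) =
      hW.channel.toLinearMap (hV.channel.toLinearMap (ketBra x y)) := by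
  refine traceClass_ext fun z z' => ?_
  have h1 := (Equiv.prodComm κ ι).hasSum_iff.mpr ((hW.comp hV).hasSum_channel_ketBra x y z z')
  refine (h1.prod_fiberwise fun m => ?_).unique (hW.hasSum_channel _ z z')
  have h2 := hV.hasSum_channel_ketBra x y (adjoint (W m) z) (adjoint (W m) z')
  simpa [adjoint_inner_left, adjoint_inner_right] using h2

end Comp

/-! ### Criteria for reversibility on complete and on nonorthogonal families. -/

section

variable {A B ι : Type*} [NormedAddCommGroup A] [InnerProductSpace ℂ A] [CompleteSpace A]
  [NormedAddCommGroup B] [InnerProductSpace ℂ B] [CompleteSpace B] {V : ι → A →L[ℂ] B}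

/-- Since `∑ₘ (W m)† (W m) = 1`, inner products of the `V k φ` can be computed after applying the `W
m`, where members of the family are eigenvectors. -/
theorem IsKraus.dense_jointEigenvector (h : IsKraus V) (hrev : ReversibleComplete h.channel) :
    Dense (Submodule.span ℂ {φ | IsJointEigenvector V φ} : Set A) := by
  obtain ⟨S, -, hcomplete, Λ, hΛ⟩ := hrev
  obtain ⟨κ, W, hW, rfl⟩ := Λ.exists_kraus
  refine hcomplete.mono (Submodule.span_mono ?_)
  have heig : ∀ φ : A, ‖φ‖ = 1 → ketBra φ φ ∈ S → ∃ r : ι × κ → ℂ,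
      ∀ p : ι × κ, W p.2 (V p.1 φ) = r p • φ := fun φ hφ hS =>
    ⟨_, (hW.comp h).eq_smul_of_channel_fixed hφ ((hW.comp_channel_ketBra h φ φ).trans (hΛ _ hS))⟩
  rintro φ ⟨hφ, hφS⟩
  obtain ⟨r, hr⟩ := heig φ hφ hφS
  refine ⟨fun k l => ∑' m, (starRingEnd ℂ) (r (l, m)) * r (k, m), fun k l a => ?_⟩
  have key : innerSL ℂ (V l φ) ∘L V k =
      (∑' m, (starRingEnd ℂ) (r (l, m)) * r (k, m)) • innerSL ℂ φ := by
    refine ContinuousLinearMap.ext_on hcomplete ?_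
    rintro ψ ⟨hψ, hψS⟩
    obtain ⟨s, hs⟩ := heig ψ hψ hψS
    have h1 := hW.hasSum_inner (V l φ) (V k ψ)
    have h2 : ∀ m, ⟪W m (V l φ), W m (V k ψ)⟫_ℂ =
        (starRingEnd ℂ) (r (l, m)) * r (k, m) * ⟪φ, ψ⟫_ℂ := fun m => by
      rw [hr (l, m), hs (k, m), inner_smul_left, inner_smul_right]
      -- Orthogonal members may have different multipliers, but then both sides vanish.
      by_cases h0 : ⟪φ, ψ⟫_ℂ = 0
      · simp [h0]
      · rw [(hW.comp h).eigenvalue_eq hr hs h0, mul_assoc]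
    simp only [h2] at h1
    change ⟪V l φ, V k ψ⟫_ℂ = _ * ⟪φ, ψ⟫_ℂ
    rw [← h1.tsum_eq, tsum_mul_right]
  exact congrArg (fun f => f a) key

theorem ketBra_eq_smul {H : Type*} [NormedAddCommGroup H] [InnerProductSpace ℂ H] {φ ψ : H}
    (hφ : ‖φ‖ = 1) (h : ketBra φ φ = ketBra ψ ψ) : φ = ⟪ψ, φ⟫_ℂ • ψ := by
  have := congrArg (fun R : traceClass H => (R : H →L[ℂ] H) φ) h
  simp only [ketBra, rankOne_apply, inner_self_eq_norm_sq_to_K, hφ] at this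
  simpa using this

/-- The reversing channel measures which of the mutually orthogonal subspaces `G i` contains the
output and prepares `e i`. -/
theorem IsKraus.reversibleCompleteOrthogonal [Nontrivial A] (h : IsKraus V)
    (hV : Dense (Submodule.span ℂ {φ | IsJointEigenvector V φ} : Set A)) :
    ReversibleCompleteOrthogonal h.channel := by
  obtain ⟨σ, e, he⟩ := exists_hilbertBasis_jointEigenvector hV
  have hVe : ∀ i j, i ≠ j → ∀ k l, ⟪V l (e i), V k (e j)⟫_ℂ = 0 := fun i j hij k l => by
    obtain ⟨c, hc⟩ := he i
    rw [hc, e.orthonormal.2 hij, mul_zero]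
  let G : σ → Submodule ℂ B := fun i =>
    (Submodule.span ℂ (Set.range fun k => V k (e i))).topologicalClosure
  have hVG : ∀ i k, V k (e i) ∈ G i := fun i k =>
    Submodule.le_topologicalClosure _ (Submodule.subset_span ⟨k, rfl⟩)
  have hGle : ∀ i (K : Submodule ℂ B), (∀ k, V k (e i) ∈ Kᗮ) → G i ≤ Kᗮ := fun i K hK =>
    Submodule.topologicalClosure_minimal _
      (Submodule.span_le.mpr (by rintro _ ⟨k, rfl⟩; exact hK k)) K.isClosed_orthogonal
  have hGG : ∀ i j, i ≠ j → G i ⟂ G j := fun i j hij => by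
    refine hGle i _ fun k => ?_
    have h1 : G j ≤ (ℂ ∙ V k (e i))ᗮ := hGle j _ fun l =>
      Submodule.mem_orthogonal_singleton_iff_inner_right.mpr (hVe i j hij l k)
    exact (Submodule.mem_orthogonal _ _).mpr fun x hx =>
      Submodule.mem_orthogonal_singleton_iff_inner_left.mp (h1 hx)
  -- The index `none` holds what the subspaces `G i` leave over. No `V k (e i)` has a component
  -- there, so any unit vector `u` may be prepared on it.
  let F : Option σ → Submodule ℂ B := fun o => o.elim (⨆ i, G i)ᗮ G
  obtain ⟨ν, g, τ, hg⟩ := exists_hilbertBasis_mem F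
    (by
      rintro (_ | i)
      · exact Submodule.isClosed_orthogonal _
      · exact Submodule.isClosed_topologicalClosure _)
    (by
      rintro (_ | i) (_ | j) hij x hx y hy
      · exact absurd rfl hij
      · exact inner_eq_zero_symm.mp
          ((Submodule.mem_orthogonal _ _).mp hx y (Submodule.mem_iSup_of_mem j hy))
      · exact (Submodule.mem_orthogonal _ _).mp hy x (Submodule.mem_iSup_of_mem i hx)
      · exact (hGG i j fun h => hij (congrArg some h)).inner_eq hx hy)
    (fun x hx => by
      have hx' : x ∈ (⨆ i, G i)ᗮ := by
        rw [← Submodule.iInf_orthogonal, Submodule.mem_iInf]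
        exact fun i => (Submodule.mem_orthogonal _ _).mpr fun y hy => hx (some i) y hy
      exact inner_self_eq_zero.mp (hx none x hx'))
  obtain ⟨u, hu⟩ := exists_norm_eq A zero_le_one
  let e' : Option σ → A := fun o => o.elim u e
  have he' : ∀ o, ‖e' o‖ = 1 := by
    rintro (_ | i)
    · exact hu
    · exact e.orthonormal.1 i
  let M : ν → B →L[ℂ] A := fun s => rankOne ℂ (e' (τ s)) (g s)
  have hM : IsKraus M := fun b => by
    refine (hasSum_norm_inner_sq g b).congr_fun fun s => ?_
    rw [rankOne_apply, norm_smul, he', mul_one]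
  have heig : ∀ i (p : ι × ν), M p.2 (V p.1 (e i)) = ⟪g p.2, V p.1 (e i)⟫_ℂ • e i := by
    rintro i ⟨k, s⟩
    change ⟪g s, V k (e i)⟫_ℂ • e' (τ s) = ⟪g s, V k (e i)⟫_ℂ • e i
    by_cases hτ : τ s = some i
    · rw [hτ]; rfl
    · have : ⟪g s, V k (e i)⟫_ℂ = 0 := by
        have hgs := hg s
        rcases hs : τ s with _ | j
        · rw [hs] at hgs
          exact inner_eq_zero_symm.mp
            ((Submodule.mem_orthogonal _ _).mp hgs _ (Submodule.mem_iSup_of_mem i (hVG i k)))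
        · rw [hs] at hgs
          refine (hGG j i ?_).inner_eq hgs (hVG i k)
          rintro rfl
          exact hτ hs
      rw [this, zero_smul, zero_smul]
  refine ⟨Set.range fun i => ketBra (e i) (e i), ?_, ?_, ?_, hM.channel, ?_⟩
  · rintro _ ⟨i, rfl⟩
    exact ⟨e i, e.orthonormal.1 i, rfl⟩
  · have hd : Dense (Submodule.span ℂ (Set.range e) : Set A) := by
      rw [dense_iff_closure_eq, ← Submodule.topologicalClosure_coe, e.dense_span]
      rfl
    refine hd.mono (Submodule.span_mono ?_)
    rintro _ ⟨i, rfl⟩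
    exact ⟨e.orthonormal.1 i, i, rfl⟩
  · rintro φ ψ hφ hψ ⟨i, hi⟩ ⟨j, hj⟩ hne
    have hij : i ≠ j := by
      rintro rfl
      exact hne (hi.symm.trans hj)
    rw [ketBra_eq_smul hφ hi.symm, ketBra_eq_smul hψ hj.symm, inner_smul_left, inner_smul_right,
      e.orthonormal.2 hij, mul_zero, mul_zero]
  · rintro _ ⟨i, rfl⟩
    change hM.channel.toLinearMap (h.channel.toLinearMap (ketBra (e i) (e i))) = _
    rw [← hM.comp_channel_ketBra h]
    exact (hM.comp h).channel_ketBra_of_eigen (heig i) (heig i)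

theorem nonempty_of_isCompleteFamily {H : Type*} [NormedAddCommGroup H] [InnerProductSpace ℂ H]
    [Nontrivial H] {S : Set (traceClass H)} (hS : IsCompleteFamily S) :
    ∃ φ : H, ‖φ‖ = 1 ∧ ketBra φ φ ∈ S := by
  by_contra hne
  have hempty : {φ : H | ‖φ‖ = 1 ∧ ketBra φ φ ∈ S} = ∅ :=
    Set.eq_empty_iff_forall_notMem.mpr fun φ hφ => hne ⟨φ, hφ⟩
  obtain ⟨x, hx⟩ := exists_ne (0 : H)
  have hd : Dense (Submodule.span ℂ {φ : H | ‖φ‖ = 1 ∧ ketBra φ φ ∈ S} : Set H) := hS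
  rw [hempty, Submodule.span_empty] at hd
  have := hd.closure_eq
  simp at this

/-- All members are nonorthogonal to one fixed `φ`, hence have its multipliers, and the family spans
densely. -/
theorem IsKraus.exists_scalar_of_reversibleCompleteNonorthogonal {A : Type u} {B : Type v}
    [NormedAddCommGroup A] [InnerProductSpace ℂ A] [CompleteSpace A]
    [NormedAddCommGroup B] [InnerProductSpace ℂ B] [CompleteSpace B] {V : ι → A →L[ℂ] B}
    [Nontrivial A] (h : IsKraus V) (hrev : ReversibleCompleteNonorthogonal h.channel) :
    ∃ (κ : Type (max u v)) (W : κ → B →L[ℂ] A) (_ : IsKraus W) (r : ι × κ → ℂ),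
      ∀ p a, W p.2 (V p.1 a) = r p • a := by
  obtain ⟨S, -, hcomplete, hnon, Λ, hΛ⟩ := hrev
  obtain ⟨κ, W, hW, rfl⟩ := Λ.exists_kraus
  have heig : ∀ φ : A, ‖φ‖ = 1 → ketBra φ φ ∈ S → ∃ r : ι × κ → ℂ,
      ∀ p : ι × κ, W p.2 (V p.1 φ) = r p • φ := fun φ hφ hS =>
    ⟨_, (hW.comp h).eq_smul_of_channel_fixed hφ ((hW.comp_channel_ketBra h φ φ).trans (hΛ _ hS))⟩
  obtain ⟨φ, hφ, hφS⟩ := nonempty_of_isCompleteFamily hcomplete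
  obtain ⟨r, hr⟩ := heig φ hφ hφS
  refine ⟨κ, W, hW, r, fun p a => ?_⟩
  have key : W p.2 ∘L V p.1 = r p • ContinuousLinearMap.id ℂ A := by
    refine ContinuousLinearMap.ext_on hcomplete ?_
    rintro ψ ⟨hψ, hψS⟩
    obtain ⟨s, hs⟩ := heig ψ hψ hψS
    rw [(hW.comp h).eigenvalue_eq hr hs (hnon φ ψ hφ hψ hφS hψS)]
    exact hs p
  exact congrArg (fun f => f a) key

/-- The pure states with fidelity more than one half to a fixed pure state. -/
theorem exists_complete_nonorthogonal_family (H : Type*) [NormedAddCommGroup H]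
    [InnerProductSpace ℂ H] [Nontrivial H] :
    ∃ S : Set (traceClass H), IsPureFamily S ∧ IsCompleteFamily S ∧ IsNonorthogonalFamily S := by
  obtain ⟨u, hu⟩ := exists_norm_eq H zero_le_one
  have huu : ⟪u, u⟫_ℂ = 1 := by rw [inner_self_eq_norm_sq_to_K, hu]; simp
  let S : Set (traceClass H) := {ρ | ∃ φ : H, ‖φ‖ = 1 ∧ 1 / 2 < ‖⟪u, φ⟫_ℂ‖ ^ 2 ∧ ρ = ketBra φ φ}
  have hS : ∀ φ : H, ketBra φ φ ∈ S → 1 / 2 < ‖⟪u, φ⟫_ℂ‖ ^ 2 := by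
    rintro φ ⟨ψ, -, hψ, h⟩
    have := congrArg (fun R : traceClass H => ‖⟪u, (R : H →L[ℂ] H) u⟫_ℂ‖) h
    simp only [ketBra, rankOne_apply, inner_smul_right, norm_mul, norm_inner_symm φ u,
      norm_inner_symm ψ u, ← sq] at this
    rwa [this]
  refine ⟨S, ?_, ?_, ?_⟩
  · rintro ρ ⟨φ, hφ, -, rfl⟩
    exact ⟨φ, hφ, rfl⟩
  · have hmem : ∀ x : H, x ≠ 0 → ‖x‖ ^ 2 < 2 * ‖⟪u, x⟫_ℂ‖ ^ 2 →
        x ∈ Submodule.span ℂ {φ : H | ‖φ‖ = 1 ∧ ketBra φ φ ∈ S} := fun x hx0 hx => by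
      have hxpos : 0 < ‖x‖ := norm_pos_iff.mpr hx0
      have hn : ‖((‖x‖ : ℂ)⁻¹) • x‖ = 1 := by
        rw [norm_smul, norm_inv, Complex.norm_real, norm_norm, inv_mul_cancel₀ hxpos.ne']
      have hx1 : x = (‖x‖ : ℂ) • ((‖x‖ : ℂ)⁻¹ • x) := by
        rw [smul_smul, mul_inv_cancel₀ (by exact_mod_cast hxpos.ne'), one_smul]
      rw [hx1]
      refine Submodule.smul_mem _ _ (Submodule.subset_span ⟨hn, _, hn, ?_, rfl⟩)
      rw [inner_smul_right, norm_mul, norm_inv, Complex.norm_real, norm_norm, mul_pow, inv_pow,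
        ← div_eq_inv_mul, lt_div_iff₀ (by positivity)]
      linarith
    have htop : Submodule.span ℂ {φ : H | ‖φ‖ = 1 ∧ ketBra φ φ ∈ S} = ⊤ := by
      rw [eq_top_iff]
      intro x _
      have hu' := hmem u (by rintro rfl; simp at hu) (by rw [huu, hu]; norm_num)
      -- Chosen so that `(t + ‖x‖)² < 2 (t - ‖x‖)²`: both `t • u + x` and `u` then lie in the span,
      -- hence so does `x`.
      set t : ℝ := 6 * ‖x‖ + 1 with ht
      have htpos : 0 < t := by positivity
      have h1 : ‖(t : ℂ) • u + x‖ ≤ t + ‖x‖ := (norm_add_le _ _).trans_eq (by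
        rw [norm_smul, hu, mul_one, Complex.norm_real, Real.norm_of_nonneg htpos.le])
      have h2 : t - ‖x‖ ≤ ‖⟪u, (t : ℂ) • u + x⟫_ℂ‖ := by
        rw [inner_add_right, inner_smul_right, huu, mul_one]
        have h3 := norm_inner_le_norm (𝕜 := ℂ) u x
        rw [hu, one_mul] at h3
        have h4 := norm_sub_le ((t : ℂ) + ⟪u, x⟫_ℂ) ⟪u, x⟫_ℂ
        rw [add_sub_cancel_right, Complex.norm_real, Real.norm_of_nonneg htpos.le] at h4
        linarith
      have h5 := norm_nonneg x
      have htx := hmem ((t : ℂ) • u + x) (by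
          intro h0
          rw [h0, inner_zero_right, norm_zero] at h2
          linarith) (by
        have h6 := pow_le_pow_left₀ (norm_nonneg _) h1 2
        have h7 := pow_le_pow_left₀ (by linarith) h2 2
        nlinarith)
      simpa using Submodule.sub_mem _ htx (Submodule.smul_mem _ (t : ℂ) hu')
    unfold IsCompleteFamily
    rw [htop]
    exact dense_univ
  · intro φ ψ hφ hψ hφS hψS h0
    have hon : Orthonormal ℂ ![φ, ψ] := by
      refine ⟨fun i => by fin_cases i <;> assumption, fun i j hij => ?_⟩
      fin_cases i <;> fin_cases j
      · exact absurd rfl hij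
      · exact h0
      · exact inner_eq_zero_symm.mp h0
      · exact absurd rfl hij
    -- Bessel: two orthogonal members would have fidelities with `u` adding up to more than `‖u‖² =
    -- 1`.
    have hb := hon.sum_inner_products_le (s := Finset.univ) u
    rw [Fin.sum_univ_two, hu] at hb
    simp only [Matrix.cons_val_zero, Matrix.cons_val_one, norm_inner_symm _ u] at hb
    linarith [hS φ hφS, hS ψ hψS]

theorem IsKraus.reversibleCompleteNonorthogonal_of_scalar [Nontrivial A] (h : IsKraus V)
    {κ : Type*} {W : κ → B →L[ℂ] A} (hW : IsKraus W) {r : ι × κ → ℂ}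
    (hr : ∀ p a, W p.2 (V p.1 a) = r p • a) : ReversibleCompleteNonorthogonal h.channel := by
  obtain ⟨S, hpure, hcomplete, hnon⟩ := exists_complete_nonorthogonal_family A
  refine ⟨S, hpure, hcomplete, hnon, hW.channel, fun ρ hρ => ?_⟩
  obtain ⟨φ, -, rfl⟩ := hpure ρ hρ
  rw [← hW.comp_channel_ketBra h]
  exact (hW.comp h).channel_ketBra_of_eigen (fun p => hr p φ) fun p => hr p φ

end

/-! ### Hilbert space tensor products, up to isomorphism -/

/-- The bounded bilinear map `t` exhibits `K` as the Hilbert space tensor product of `A`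
and `C`. -/
structure IsHilbertTensor {A C K : Type*} [NormedAddCommGroup A] [InnerProductSpace ℂ A]
    [NormedAddCommGroup C] [InnerProductSpace ℂ C] [NormedAddCommGroup K] [InnerProductSpace ℂ K]
    (t : A →L[ℂ] C →L[ℂ] K) : Prop where
  inner_eq : ∀ a a' c c', ⟪t a c, t a' c'⟫_ℂ = ⟪a, a'⟫_ℂ * ⟪c, c'⟫_ℂ
  total : ∀ x, (∀ a c, ⟪t a c, x⟫_ℂ = 0) → x = 0

theorem dense_span_of_inner {H : Type*} [NormedAddCommGroup H] [InnerProductSpace ℂ H]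
    [CompleteSpace H] {S : Set H} (h : ∀ x, (∀ s ∈ S, ⟪s, x⟫_ℂ = 0) → x = 0) :
    Dense (Submodule.span ℂ S : Set H) := by
  rw [Submodule.dense_iff_topologicalClosure_eq_top, Submodule.topologicalClosure_eq_top_iff,
    eq_bot_iff]
  exact fun x hx => h x fun s hs => (Submodule.mem_orthogonal _ _).mp hx s (Submodule.subset_span hs)

theorem eq_zero_of_dense_span {H : Type*} [NormedAddCommGroup H] [InnerProductSpace ℂ H]
    {S : Set H} (hS : Dense (Submodule.span ℂ S : Set H)) {x : H}
    (h : ∀ s ∈ S, ⟪s, x⟫_ℂ = 0) : x = 0 := by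
  have : innerSL ℂ x = 0 := ContinuousLinearMap.ext_on hS fun s hs => by
    rw [innerSL_apply_apply, zero_apply, ← inner_conj_symm, h s hs, map_zero]
  exact inner_self_eq_zero.mp (congrArg (fun f => f x) this)

theorem dense_span_hilbertBasis {H ι : Type*} [NormedAddCommGroup H] [InnerProductSpace ℂ H]
    (b : HilbertBasis ι ℂ H) : Dense (Submodule.span ℂ (Set.range b) : Set H) := by
  rw [Submodule.dense_iff_topologicalClosure_eq_top, b.dense_span]

namespace IsHilbertTensor

variable {A : Type u} {B : Type v} {C D K L ι κ : Type*}
  [NormedAddCommGroup A] [InnerProductSpace ℂ A] [NormedAddCommGroup B] [InnerProductSpace ℂ B]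
  [NormedAddCommGroup C] [InnerProductSpace ℂ C] [NormedAddCommGroup D] [InnerProductSpace ℂ D]
  [NormedAddCommGroup K] [InnerProductSpace ℂ K] [NormedAddCommGroup L] [InnerProductSpace ℂ L]
  {t : A →L[ℂ] C →L[ℂ] K} {t' : B →L[ℂ] D →L[ℂ] L}

/-- Lets every statement about the left factor serve for the right one. -/
theorem flip (ht : IsHilbertTensor t) : IsHilbertTensor t.flip where
  inner_eq a a' c c' := by
    rw [flip_apply, flip_apply, ht.inner_eq, mul_comm]
  total x hx := ht.total x fun a c => hx c a

theorem norm_eq (ht : IsHilbertTensor t) (a : A) (c : C) : ‖t a c‖ = ‖a‖ * ‖c‖ := by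
  have h := ht.inner_eq a a c c
  simp only [inner_self_eq_norm_sq_to_K, ← mul_pow] at h
  have h' : ‖t a c‖ ^ 2 = (‖a‖ * ‖c‖) ^ 2 := by exact_mod_cast h
  rwa [sq_eq_sq₀ (norm_nonneg _) (by positivity)] at h'

theorem eq_of_inner (ht : IsHilbertTensor t) {x y : K}
    (h : ∀ a c, ⟪t a c, x⟫_ℂ = ⟪t a c, y⟫_ℂ) : x = y :=
  sub_eq_zero.mp (ht.total _ fun a c => by rw [inner_sub_right, h, sub_self])

variable [CompleteSpace A] [CompleteSpace C] [CompleteSpace K]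

theorem dense_span (ht : IsHilbertTensor t) {S : Set A} {T : Set C}
    (hS : Dense (Submodule.span ℂ S : Set A)) (hT : Dense (Submodule.span ℂ T : Set C)) :
    Dense (Submodule.span ℂ (Set.image2 (fun a c => t a c) S T) : Set K) := by
  refine dense_span_of_inner fun x hx => ht.total x fun a c => ?_
  have h1 : ∀ c ∈ T, adjoint (t.flip c) x = 0 := fun c hc =>
    eq_zero_of_dense_span hS fun a ha => by
      rw [adjoint_inner_right]
      exact hx _ ⟨a, ha, c, hc, rfl⟩
  have h2 : adjoint (t a) x = 0 := eq_zero_of_dense_span hT fun c hc => by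
    have := congrArg (fun y => ⟪a, y⟫_ℂ) (h1 c hc)
    simp only [adjoint_inner_right, inner_zero_right] at this
    rw [adjoint_inner_right]
    exact this
  rw [← adjoint_inner_right, h2, inner_zero_right]

theorem ext (ht : IsHilbertTensor t) {f g : K →L[ℂ] L} (h : ∀ a c, f (t a c) = g (t a c)) :
    f = g := by
  refine ContinuousLinearMap.ext_on (ht.dense_span (S := Set.univ) (T := Set.univ) ?_ ?_) ?_
  · simp
  · simp
  · rintro _ ⟨a, -, c, -, rfl⟩
    exact h a c

/-- Parseval in the product basis, grouped by `j`. These are the Kraus operators of the partial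
trace over `C`. -/
theorem isKraus_slice (ht : IsHilbertTensor t) {σ : Type*} (f : HilbertBasis σ ℂ C) :
    IsKraus fun j => adjoint (t.flip (f j)) := fun z => by
  obtain ⟨w, e, -⟩ := exists_hilbertBasis ℂ A
  have hortho : Orthonormal ℂ fun p : σ × w => t (e p.2) (f p.1) := by
    classical
    rw [orthonormal_iff_ite]
    rintro ⟨j, i⟩ ⟨j', i'⟩
    rw [ht.inner_eq, orthonormal_iff_ite.mp e.orthonormal, orthonormal_iff_ite.mp f.orthonormal]
    by_cases hi : i = i' <;> by_cases hj : j = j' <;> simp [hi, hj]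
  let b := HilbertBasis.mkOfOrthogonalEqBot hortho (by
    rw [← Submodule.topologicalClosure_eq_top_iff, ← Submodule.dense_iff_topologicalClosure_eq_top]
    refine (ht.dense_span (dense_span_hilbertBasis e) (dense_span_hilbertBasis f)).mono
      (Submodule.span_mono ?_)
    rintro _ ⟨_, ⟨i, rfl⟩, _, ⟨j, rfl⟩, rfl⟩
    exact ⟨(j, i), rfl⟩)
  have hb := hasSum_norm_inner_sq b z
  simp only [b, HilbertBasis.coe_mkOfOrthogonalEqBot] at hb
  refine hb.prod_fiberwise fun j => ?_
  refine (hasSum_norm_inner_sq e _).congr_fun fun i => ?_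
  rw [adjoint_inner_right, flip_apply]

variable {V : ι → A →L[ℂ] B} {W : κ → C →L[ℂ] D} {R : ι × κ → K →L[ℂ] L}

theorem dense_jointEigenvector (ht : IsHilbertTensor t) (ht' : IsHilbertTensor t')
    (hR : ∀ p a c, R p (t a c) = t' (V p.1 a) (W p.2 c))
    (hV : Dense (Submodule.span ℂ {φ | IsJointEigenvector V φ} : Set A))
    (hW : Dense (Submodule.span ℂ {φ | IsJointEigenvector W φ} : Set C)) :
    Dense (Submodule.span ℂ {φ | IsJointEigenvector R φ} : Set K) := by
  refine (ht.dense_span hV hW).mono (Submodule.span_mono ?_)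
  rintro _ ⟨φ, ⟨c, hc⟩, ψ, ⟨d, hd⟩, rfl⟩
  refine ⟨fun k l => c k.1 l.1 * d k.2 l.2, fun k l z => ?_⟩
  have : innerSL ℂ (R l (t φ ψ)) ∘L R k = (c k.1 l.1 * d k.2 l.2) • innerSL ℂ (t φ ψ) := by
    refine ht.ext fun a b => ?_
    change ⟪R l (t φ ψ), R k (t a b)⟫_ℂ = _ * ⟪t φ ψ, t a b⟫_ℂ
    rw [hR, hR, ht'.inner_eq, ht.inner_eq, hc, hd]
    ring
  exact congrArg (fun f => f z) this

/-- The inverse for the left factor adjoins the output of the other channel on `|c⟩⟨c|`, applies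
`Q`, and traces out `C`; slicing `a ⊗ c` at `f j` contributes the scalar `⟪f j, c⟫`. -/
theorem exists_scalar_left [Nontrivial C] (ht : IsHilbertTensor t)
    (ht' : IsHilbertTensor t') (hR : ∀ p a c, R p (t a c) = t' (V p.1 a) (W p.2 c))
    (hW : IsKraus W) {ν : Type*} {Q : ν → L →L[ℂ] K} (hQ : IsKraus Q) {q : (ι × κ) × ν → ℂ}
    (hq : ∀ p z, Q p.2 (R p.1 z) = q p • z) :
    ∃ (w : Set C) (M : (κ × ν) × w → B →L[ℂ] A) (_ : IsKraus M) (r : ι × (κ × ν) × w → ℂ),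
      ∀ p a, M p.2 (V p.1 a) = r p • a := by
  obtain ⟨c, hc⟩ := exists_norm_eq C zero_le_one
  obtain ⟨w, f, -⟩ := exists_hilbertBasis ℂ C
  have hX : IsKraus fun m => t'.flip (W m c) := fun b => by
    have := (hW c).mul_left (‖b‖ ^ 2)
    rw [hc, one_pow, mul_one] at this
    refine this.congr_fun fun m => ?_
    rw [flip_apply, ht'.norm_eq, mul_pow]
  refine ⟨w, _, (ht.isKraus_slice f).comp (hQ.comp hX),
    fun p => q ((p.1, p.2.1.1), p.2.1.2) * ⟪f p.2.2, c⟫_ℂ, ?_⟩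
  rintro ⟨k, ⟨m, s⟩, j⟩ a
  change adjoint (t.flip (f j)) (Q s (t' (V k a) (W m c))) = _
  have h1 := hq ((k, m), s) (t a c)
  rw [hR] at h1
  rw [h1, map_smul, mul_smul]
  congr 1
  refine ext_inner_left ℂ fun a' => ?_
  rw [adjoint_inner_right, flip_apply, ht.inner_eq, inner_smul_right, mul_comm]

variable [CompleteSpace B] [CompleteSpace D] [CompleteSpace L]

theorem adjoint_apply (ht : IsHilbertTensor t) (ht' : IsHilbertTensor t')
    (hR : ∀ p a c, R p (t a c) = t' (V p.1 a) (W p.2 c)) (p : ι × κ) (b : B) (d : D) :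
    adjoint (R p) (t' b d) = t (adjoint (V p.1) b) (adjoint (W p.2) d) :=
  ht.eq_of_inner fun a c => by
    rw [adjoint_inner_right, hR, ht'.inner_eq, ht.inner_eq, adjoint_inner_right,
      adjoint_inner_right]

/-- Contracting a joint eigenvector `ω` of `R` with `c` gives a joint eigenvector of `V`: summing
the relations for `(k, m)` and `(l, m)` over `m` removes the second factor, as `∑ₘ (W m)† (W m) =
1`. A vector `x` orthogonal to all of these has `x ⊗ c` orthogonal to every `ω`. -/
theorem dense_jointEigenvector_left [Nontrivial C] (ht : IsHilbertTensor t)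
    (ht' : IsHilbertTensor t') (hR : ∀ p a c, R p (t a c) = t' (V p.1 a) (W p.2 c))
    (hW : IsKraus W) (h : Dense (Submodule.span ℂ {φ | IsJointEigenvector R φ} : Set K)) :
    Dense (Submodule.span ℂ {φ | IsJointEigenvector V φ} : Set A) := by
  obtain ⟨c, hc⟩ := exists_ne (0 : C)
  refine dense_span_of_inner fun x hx => ?_
  have hxc : t x c = 0 := eq_zero_of_dense_span h fun ω ⟨χ, hχ⟩ => ?_
  · have := ht.norm_eq x c
    rw [hxc, norm_zero, eq_comm, mul_eq_zero] at this
    exact norm_eq_zero.mp (this.resolve_right (norm_ne_zero_iff.mpr hc))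
  · have hslice : ∀ a, ⟪adjoint (t.flip c) ω, a⟫_ℂ = ⟪ω, t a c⟫_ℂ := fun a => by
      rw [adjoint_inner_left, flip_apply]
    rw [← hslice]
    -- If this series diverges for some `k`, `l`, the slice is zero, so the default value of the sum
    -- is harmless.
    refine hx _ ⟨fun k l => ∑' m, χ (k, m) (l, m), fun k l a => ?_⟩
    set y := adjoint (V l) (V k a) with hy
    have h1 := hW.hasSum_inner (adjoint (t y) ω) c
    have h2 : ∀ m, ⟪W m (adjoint (t y) ω), W m c⟫_ℂ = χ (k, m) (l, m) * ⟪ω, t a c⟫_ℂ := by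
      intro m
      rw [← hχ, hR, ← adjoint_inner_right (R _), ht.adjoint_apply ht' hR, ← adjoint_inner_right (W m),
        adjoint_inner_left]
    simp only [h2] at h1
    rw [hslice, ← tsum_mul_right, h1.tsum_eq, adjoint_inner_left, ← hslice, hy, adjoint_inner_right]

end IsHilbertTensor

/-! ### The tensor product channel -/

/-- A family of operators that is Kraus on a dense set is Kraus. -/
theorem isKraus_of_dense {H K ι : Type*} [NormedAddCommGroup H] [InnerProductSpace ℂ H]
    [NormedAddCommGroup K] [InnerProductSpace ℂ K] {R : ι → H →L[ℂ] K} {S : Set H} (hS : Dense S)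
    (h : ∀ z ∈ S, HasSum (fun k => ‖R k z‖ ^ 2) (‖z‖ ^ 2)) : IsKraus R := by
  have hle : ∀ (s : Finset ι) z, ∑ k ∈ s, ‖R k z‖ ^ 2 ≤ ‖z‖ ^ 2 := fun s z => by
    have hcl : IsClosed {z | ∑ k ∈ s, ‖R k z‖ ^ 2 ≤ ‖z‖ ^ 2} :=
      isClosed_le (by fun_prop) (by fun_prop)
    exact hcl.closure_subset_iff.mpr
      (fun z hz => sum_le_hasSum s (fun _ _ => by positivity) (h z hz)) (hS z)
  have htwo : 0 < (2 : ENNReal).toReal := by norm_num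
  have hmem : ∀ z, Memℓp (fun k => R k z) 2 := fun z =>
    memℓp_gen (by simpa using summable_of_sum_le (fun k => by positivity) fun s => hle s z)
  -- As one bounded map into `ℓ²`, the family has a norm continuous in `z`, so the identity passes
  -- from `S` to its closure.
  let T : H →L[ℂ] lp (fun _ : ι => K) 2 := LinearMap.mkContinuous
    { toFun := fun z => ⟨fun k => R k z, hmem z⟩
      map_add' := fun x y => Subtype.ext (funext fun k => map_add (R k) x y)
      map_smul' := fun c x => Subtype.ext (funext fun k => map_smul (R k) c x) } 1 fun z => by
    rw [one_mul]
    exact lp.norm_le_of_forall_sum_le htwo (norm_nonneg _) fun s => by simpa using hle s z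
  have hT : ∀ z, HasSum (fun k => ‖R k z‖ ^ 2) (‖T z‖ ^ 2) := fun z => by
    have h := lp.hasSum_norm htwo (T z)
    simp only [ENNReal.toReal_ofNat, Real.rpow_ofNat] at h
    exact h
  have hnorm : ∀ z, ‖T z‖ ^ 2 = ‖z‖ ^ 2 := fun z => by
    have hcl : IsClosed {z | ‖T z‖ ^ 2 = ‖z‖ ^ 2} := isClosed_eq (by fun_prop) (by fun_prop)
    exact hcl.closure_subset_iff.mpr (fun z hz => (hT z).unique (h z hz)) (hS z)
  intro z
  rw [← hnorm]
  exact hT z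

theorem hasSum_mul_prod {ι κ : Type*} {f : ι → ℂ} {g : κ → ℂ} {a b : ℂ} (hf : HasSum f a)
    (hg : HasSum g b) : HasSum (fun p : ι × κ => f p.1 * g p.2) (a * b) :=
  hf.mul hg (summable_mul_of_summable_norm hf.summable.norm hg.summable.norm)

section

variable {A B C D ι κ : Type*}
  [NormedAddCommGroup A] [InnerProductSpace ℂ A] [NormedAddCommGroup B] [InnerProductSpace ℂ B]
  [NormedAddCommGroup C] [InnerProductSpace ℂ C] [NormedAddCommGroup D] [InnerProductSpace ℂ D]

/-- The elementary tensor as a bounded bilinear map. -/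
def elemTensorL (A C : Type*) [NormedAddCommGroup A] [InnerProductSpace ℂ A]
    [NormedAddCommGroup C] [InnerProductSpace ℂ C] : A →L[ℂ] C →L[ℂ] HilbertTensor A C :=
  LinearMap.mkContinuous₂
    (LinearMap.mk₂ ℂ elemTensor elemTensor_add_left elemTensor_smul_left elemTensor_add_right
      elemTensor_smul_right) 1 fun a c => by
    rw [LinearMap.mk₂_apply, norm_elemTensor, one_mul]

theorem elemTensorL_apply (a : A) (c : C) : elemTensorL A C a c = elemTensor a c := rfl

theorem isHilbertTensor_elemTensorL : IsHilbertTensor (elemTensorL A C) where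
  inner_eq := fun a a' c c' => inner_elemTensor a a' c c'
  total := fun x hx => by
    have h : ∀ z : HilbertTensor A C, ⟪z, x⟫_ℂ = 0 := fun z => by
      induction z using UniformSpace.Completion.induction_on with
      | hp => exact isClosed_eq (by fun_prop) continuous_const
      | ih z =>
        induction z using TensorProduct.induction_on with
        | zero => rw [UniformSpace.Completion.coe_zero, inner_zero_left]
        | tmul a c => exact hx a c
        | add z w hz hw => rw [UniformSpace.Completion.coe_add, inner_add_left, hz, hw, add_zero]
    exact inner_self_eq_zero.mp (h x)

/-- The tensor product of two operators between different spaces. -/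
def mapTensor (S : A →L[ℂ] B) (T : C →L[ℂ] D) : HilbertTensor A C →L[ℂ] HilbertTensor B D :=
  (TensorProduct.mapL S T).completion

theorem mapTensor_elemTensor (S : A →L[ℂ] B) (T : C →L[ℂ] D) (a : A) (c : C) :
    mapTensor S T (elemTensor a c) = elemTensor (S a) (T c) := by
  simp [mapTensor, elemTensor]

/-- The norm identity is not additive, so its polarized form is proved on elementary tensors,
extended by linearity to the algebraic tensor product, and specialized to norms before passing to
the completion. -/
theorem IsKraus.tensor {V : ι → A →L[ℂ] B} {W : κ → C →L[ℂ] D} (hV : IsKraus V)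
    (hW : IsKraus W) : IsKraus fun p : ι × κ => mapTensor (V p.1) (W p.2) := by
  have htmul : ∀ a a' c c', HasSum (fun p : ι × κ =>
      ⟪TensorProduct.mapL (V p.1) (W p.2) (a ⊗ₜ[ℂ] c),
        TensorProduct.mapL (V p.1) (W p.2) (a' ⊗ₜ[ℂ] c')⟫_ℂ)
      ⟪a ⊗ₜ[ℂ] c, a' ⊗ₜ[ℂ] c'⟫_ℂ := fun a a' c c' => by
    have h := hasSum_mul_prod (hV.hasSum_inner a a') (hW.hasSum_inner c c')
    rw [← TensorProduct.inner_tmul] at h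
    refine h.congr_fun fun p => ?_
    rw [TensorProduct.mapL_tmul, TensorProduct.mapL_tmul, TensorProduct.inner_tmul]
  have hleft : ∀ a c (z' : A ⊗[ℂ] C), HasSum (fun p : ι × κ =>
      ⟪TensorProduct.mapL (V p.1) (W p.2) (a ⊗ₜ[ℂ] c), TensorProduct.mapL (V p.1) (W p.2) z'⟫_ℂ)
      ⟪a ⊗ₜ[ℂ] c, z'⟫_ℂ := fun a c z' => by
    induction z' using TensorProduct.induction_on with
    | zero => simp only [map_zero, inner_zero_right]; exact hasSum_zero
    | add x y hx hy => simp only [map_add, inner_add_right]; exact hx.add hy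
    | tmul a' c' => exact htmul a a' c c'
  have hinner : ∀ z z' : A ⊗[ℂ] C, HasSum (fun p : ι × κ =>
      ⟪TensorProduct.mapL (V p.1) (W p.2) z, TensorProduct.mapL (V p.1) (W p.2) z'⟫_ℂ)
      ⟪z, z'⟫_ℂ := fun z z' => by
    induction z using TensorProduct.induction_on with
    | zero => simp only [map_zero, inner_zero_left]; exact hasSum_zero
    | add x y hx hy => simp only [map_add, inner_add_left]; exact hx.add hy
    | tmul a c => exact hleft a c z'
  refine isKraus_of_dense (S := Set.range ((↑) : A ⊗[ℂ] C → HilbertTensor A C))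
    UniformSpace.Completion.denseRange_coe ?_
  rintro _ ⟨z, rfl⟩
  have h := Complex.hasSum_re (hinner z z)
  simp only [← RCLike.re_eq_complex_re, inner_self_eq_norm_sq] at h
  simp only [mapTensor, ContinuousLinearMap.completion_apply_coe, UniformSpace.Completion.norm_coe]
  convert h using 1
  exact (inner_self_eq_norm_sq (𝕜 := ℂ) z).symm

variable [CompleteSpace A] [CompleteSpace B] [CompleteSpace C] [CompleteSpace D]

theorem IsKraus.isTensorChannel {V : ι → A →L[ℂ] B} {W : κ → C →L[ℂ] D} (hV : IsKraus V)
    (hW : IsKraus W) : IsTensorChannel hV.channel hW.channel (hV.tensor hW).channel := by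
  intro ρ σ
  refine Subtype.ext (opTensor_ext fun b' d' => ?_)
  refine isHilbertTensor_elemTensorL.eq_of_inner fun b d => ?_
  rw [elemTensorL_apply]
  refine ((hV.tensor hW).hasSum_channel _ _ _).unique ?_
  have h1 := hV.hasSum_channel ρ b b'
  have h2 := hW.hasSum_channel σ d d'
  have hadj : ∀ (p : ι × κ) (b : B) (d : D),
      adjoint (mapTensor (V p.1) (W p.2)) (elemTensor b d) =
        elemTensor (adjoint (V p.1) b) (adjoint (W p.2) d) := fun p b d =>
    isHilbertTensor_elemTensorL.adjoint_apply isHilbertTensor_elemTensorL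
      (R := fun p : ι × κ => mapTensor (V p.1) (W p.2)) (V := V) (W := W)
      (fun p a c => mapTensor_elemTensor _ _ a c) p b d
  have hR : ((traceClassTensor (hV.channel.toLinearMap ρ) (hW.channel.toLinearMap σ) :
      traceClass (HilbertTensor B D)) : HilbertTensor B D →L[ℂ] HilbertTensor B D)
      (elemTensor b' d') = elemTensor ((hV.channel.toLinearMap ρ : B →L[ℂ] B) b')
        ((hW.channel.toLinearMap σ : D →L[ℂ] D) d') := opTensor_elemTensor _ _ _ _
  rw [hR, inner_elemTensor]
  refine (hasSum_mul_prod h1 h2).congr_fun fun p => ?_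
  rw [hadj, hadj, traceClassTensor, opTensor_elemTensor, inner_elemTensor]

/-- Operators `|a ⊗ c⟩⟨a' ⊗ c'|` are themselves product operators, and elementary tensors are total.
-/
theorem IsTensorChannel.unique {Φ : QuantumChannel A B} {Ψ : QuantumChannel C D}
    {Θ Θ' : QuantumChannel (HilbertTensor A C) (HilbertTensor B D)}
    (h : IsTensorChannel Φ Ψ Θ) (h' : IsTensorChannel Φ Ψ Θ') : Θ = Θ' := by
  refine QuantumChannel.ext_of_dense (S := Set.image2 (fun a c => elemTensorL A C a c)
    Set.univ Set.univ) (isHilbertTensor_elemTensorL.dense_span (by simp) (by simp)) ?_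
  rintro _ ⟨a, -, c, -, rfl⟩ _ ⟨a', -, c', -, rfl⟩
  have : ketBra (elemTensorL A C a c) (elemTensorL A C a' c') =
      traceClassTensor (ketBra a a') (ketBra c c') :=
    Subtype.ext (opTensor_rankOne a a' c c').symm
  rw [this, h, h']

end

/-! ### Multiplicativity of the reversibility index -/

theorem ReversibleCompleteOrthogonal.reversibleComplete {A B : Type*} [NormedAddCommGroup A]
    [InnerProductSpace ℂ A] [CompleteSpace A] [NormedAddCommGroup B] [InnerProductSpace ℂ B]
    [CompleteSpace B] {Φ : QuantumChannel A B}
    (h : ReversibleCompleteOrthogonal Φ) : ReversibleComplete Φ :=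
  let ⟨S, h1, h2, _, h3⟩ := h
  ⟨S, h1, h2, h3⟩

theorem ReversibleCompleteNonorthogonal.reversibleComplete {A B : Type*} [NormedAddCommGroup A]
    [InnerProductSpace ℂ A] [CompleteSpace A] [NormedAddCommGroup B] [InnerProductSpace ℂ B]
    [CompleteSpace B] {Φ : QuantumChannel A B}
    (h : ReversibleCompleteNonorthogonal Φ) : ReversibleComplete Φ :=
  let ⟨S, h1, h2, _, h3⟩ := h
  ⟨S, h1, h2, h3⟩

theorem IsJointEigenvector.comp_equiv {A B ι κ : Type*} [NormedAddCommGroup A] [InnerProductSpace ℂ A]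
    [NormedAddCommGroup B] [InnerProductSpace ℂ B] {V : ι → A →L[ℂ] B} {φ : A}
    (h : IsJointEigenvector V φ) (e : κ ≃ ι) : IsJointEigenvector (fun k => V (e k)) φ :=
  let ⟨c, hc⟩ := h
  ⟨fun k l => c (e k) (e l), fun k l => hc (e k) (e l)⟩

section

variable {A B C D : Type*}
  [NormedAddCommGroup A] [InnerProductSpace ℂ A] [CompleteSpace A] [Nontrivial A]
  [NormedAddCommGroup B] [InnerProductSpace ℂ B] [CompleteSpace B]
  [NormedAddCommGroup C] [InnerProductSpace ℂ C] [CompleteSpace C] [Nontrivial C]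
  [NormedAddCommGroup D] [InnerProductSpace ℂ D] [CompleteSpace D]

theorem ReversibleComplete.orthogonal {Φ : QuantumChannel A B} (h : ReversibleComplete Φ) :
    ReversibleCompleteOrthogonal Φ := by
  obtain ⟨ι, V, hV, rfl⟩ := Φ.exists_kraus
  exact hV.reversibleCompleteOrthogonal (hV.dense_jointEigenvector h)

theorem IsKraus.reversibleComplete_iff {ι : Type*} {V : ι → A →L[ℂ] B} (h : IsKraus V) :
    ReversibleComplete h.channel ↔
      Dense (Submodule.span ℂ {φ | IsJointEigenvector V φ} : Set A) :=
  ⟨h.dense_jointEigenvector, fun hV => (h.reversibleCompleteOrthogonal hV).reversibleComplete⟩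

open Classical in
-- The trichotomy, with the index expressed through two nested conditions, each of which is
-- multiplicative under tensor products.
theorem hasRi₁_ite (Φ : QuantumChannel A B) :
    HasRi₁ Φ (if ReversibleCompleteNonorthogonal Φ then 2 else
      if ReversibleComplete Φ then 1 else 0) := by
  split_ifs with h2 h1
  · exact h2
  · exact ⟨h1.orthogonal, h2⟩
  · exact h1

instance : Nontrivial (HilbertTensor A C) := by
  obtain ⟨a, ha⟩ := exists_norm_eq A zero_le_one
  obtain ⟨c, hc⟩ := exists_norm_eq C zero_le_one
  refine ⟨elemTensor a c, 0, fun h => ?_⟩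
  have := norm_elemTensor a c
  rw [h, ha, hc, norm_zero, one_mul] at this
  exact zero_ne_one this

theorem reversibleComplete_tensor_iff {ι κ : Type*} {V : ι → A →L[ℂ] B} {W : κ → C →L[ℂ] D}
    (hV : IsKraus V) (hW : IsKraus W) : ReversibleComplete (hV.tensor hW).channel ↔
      ReversibleComplete hV.channel ∧ ReversibleComplete hW.channel := by
  have hAC : IsHilbertTensor (elemTensorL A C) := isHilbertTensor_elemTensorL
  have hBD : IsHilbertTensor (elemTensorL B D) := isHilbertTensor_elemTensorL
  have hR : ∀ (p : ι × κ) a c, mapTensor (V p.1) (W p.2) (elemTensorL A C a c) =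
      elemTensorL B D (V p.1 a) (W p.2 c) := fun p a c => mapTensor_elemTensor _ _ a c
  rw [IsKraus.reversibleComplete_iff, IsKraus.reversibleComplete_iff,
    IsKraus.reversibleComplete_iff]
  refine ⟨fun h => ⟨hAC.dense_jointEigenvector_left hBD hR hW h, ?_⟩,
    fun h => hAC.dense_jointEigenvector hBD hR h.1 h.2⟩
  -- The right factor, by exchanging the factors and the two components of the Kraus index.
  refine hAC.flip.dense_jointEigenvector_left hBD.flip
    (R := fun p : κ × ι => mapTensor (V p.2) (W p.1)) (fun p c a => hR p.swap a c) hV ?_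
  exact h.mono (Submodule.span_mono fun φ hφ => hφ.comp_equiv (Equiv.prodComm κ ι))

theorem reversibleCompleteNonorthogonal_tensor_iff {ι κ : Type*} {V : ι → A →L[ℂ] B}
    {W : κ → C →L[ℂ] D} (hV : IsKraus V) (hW : IsKraus W) :
    ReversibleCompleteNonorthogonal (hV.tensor hW).channel ↔
      ReversibleCompleteNonorthogonal hV.channel ∧ ReversibleCompleteNonorthogonal hW.channel := by
  have hAC : IsHilbertTensor (elemTensorL A C) := isHilbertTensor_elemTensorL
  have hBD : IsHilbertTensor (elemTensorL B D) := isHilbertTensor_elemTensorL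
  have hR : ∀ (p : ι × κ) a c, mapTensor (V p.1) (W p.2) (elemTensorL A C a c) =
      elemTensorL B D (V p.1 a) (W p.2 c) := fun p a c => mapTensor_elemTensor _ _ a c
  refine ⟨fun h => ?_, fun ⟨h, h'⟩ => ?_⟩
  · obtain ⟨ν, Q, hQ, q, hq⟩ :=
      (hV.tensor hW).exists_scalar_of_reversibleCompleteNonorthogonal h
    constructor
    · obtain ⟨_, M, hM, r, hr⟩ := hAC.exists_scalar_left hBD hR hW hQ hq
      exact hV.reversibleCompleteNonorthogonal_of_scalar hM hr
    · obtain ⟨_, M, hM, r, hr⟩ := hAC.flip.exists_scalar_left hBD.flip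
        (R := fun p : κ × ι => mapTensor (V p.2) (W p.1)) (fun p c a => hR p.swap a c) hV hQ
        (q := fun p => q (p.1.swap, p.2)) fun p z => hq (p.1.swap, p.2) z
      exact hW.reversibleCompleteNonorthogonal_of_scalar hM hr
  · obtain ⟨ν, M, hM, r, hr⟩ := hV.exists_scalar_of_reversibleCompleteNonorthogonal h
    obtain ⟨ν', M', hM', r', hr'⟩ := hW.exists_scalar_of_reversibleCompleteNonorthogonal h'
    refine (hV.tensor hW).reversibleCompleteNonorthogonal_of_scalar (hM.tensor hM')
      (r := fun p => r (p.1.1, p.2.1) * r' (p.1.2, p.2.2)) fun p z => ?_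
    have : mapTensor (M p.2.1) (M' p.2.2) ∘L mapTensor (V p.1.1) (W p.1.2) =
        (r (p.1.1, p.2.1) * r' (p.1.2, p.2.2)) • ContinuousLinearMap.id ℂ (HilbertTensor A C) := by
      refine hAC.ext fun a c => ?_
      have h1 := hr (p.1.1, p.2.1) a
      have h2 := hr' (p.1.2, p.2.2) c
      rw [comp_apply, elemTensorL_apply, mapTensor_elemTensor, mapTensor_elemTensor, h1, h2,
        elemTensor_smul_left, elemTensor_smul_right, smul_smul]
      rfl
    exact congrArg (fun f => f z) this

end

end QuantumReversibility

end

theorem mainTheorem10 {A B C D : Type*}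
    [NormedAddCommGroup A] [InnerProductSpace ℂ A] [CompleteSpace A]
    [TopologicalSpace.SeparableSpace A] [Nontrivial A]
    [NormedAddCommGroup B] [InnerProductSpace ℂ B] [CompleteSpace B]
    [TopologicalSpace.SeparableSpace B]
    [NormedAddCommGroup C] [InnerProductSpace ℂ C] [CompleteSpace C]
    [TopologicalSpace.SeparableSpace C] [Nontrivial C]
    [NormedAddCommGroup D] [InnerProductSpace ℂ D] [CompleteSpace D]
    [TopologicalSpace.SeparableSpace D]
    (Φ : QuantumReversibility.QuantumChannel A B) (Ψ : QuantumReversibility.QuantumChannel C D) :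
    ∃ Θ : QuantumReversibility.QuantumChannel
        (QuantumReversibility.HilbertTensor A C) (QuantumReversibility.HilbertTensor B D),
      QuantumReversibility.IsTensorChannel Φ Ψ Θ ∧
      (∀ Θ', QuantumReversibility.IsTensorChannel Φ Ψ Θ' → Θ' = Θ) ∧
      ∃ k l : ℕ, QuantumReversibility.HasRi₁ Φ k ∧ QuantumReversibility.HasRi₁ Ψ l ∧
        QuantumReversibility.HasRi₁ Θ (min k l) := by
  classical
  obtain ⟨ι, V, hV, rfl⟩ := Φ.exists_kraus
  obtain ⟨κ, W, hW, rfl⟩ := Ψ.exists_kraus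
  refine ⟨(hV.tensor hW).channel, hV.isTensorChannel hW,
    fun Θ' h => h.unique (hV.isTensorChannel hW), _, _,
    QuantumReversibility.hasRi₁_ite _, QuantumReversibility.hasRi₁_ite _, ?_⟩
  -- Both conditions for the product are conjunctions over the factors, and the nonorthogonal one
  -- implies the other, so the nested conditionals agree with `min`.
  convert QuantumReversibility.hasRi₁_ite (hV.tensor hW).channel using 1
  rw [QuantumReversibility.reversibleComplete_tensor_iff hV hW,
    QuantumReversibility.reversibleCompleteNonorthogonal_tensor_iff hV hW]
  have h1 := fun h : QuantumReversibility.ReversibleCompleteNonorthogonal hV.channel =>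
    h.reversibleComplete
  have h2 := fun h : QuantumReversibility.ReversibleCompleteNonorthogonal hW.channel =>
    h.reversibleComplete
  split_ifs <;> simp_all
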